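/- **Setting.** Let $d\ge 1$, let $\mathcal D\subset\mathbb R^d$, and let $\{P_v\}_{v\in\mathcal V}$ be compact convex polytopes with disjoint interiors that cover $\mathcal D$, each labelled by a point $v$ of its interior, such that every compact subset of $\mathcal D$ meets only finitely many of them. Two distinct vertices $v,w\in\mathcal V$ are joined by an edge, $(w,v)\in\mathcal E$, if $H_{(w,v)}:=P_w\cap P_v$ has dimension $d-1$. Assume that this tiling is orthogonal: $w-v$ is orthogonal to the hyperplane containing $P_w\cap P_v$ for every edge $(w,v)$. For a function $h$ on vertices put $$\Delta^{\mathcal G}_{\mathbf a}h(v)=\sum_{(w,v)\in\mathcal E}\mathbf a(w,v)\,(h(w)-h(v)),\qquad \mathbf a(w,v)=\frac{\mathrm{vol}_{d-1}(P_w\cap P_v)}{\|w-v\|},$$ and for an edge $e=(w,v)$ let $Q_e=\mathrm{conv}(\{w\}\cup H_e)\cup\mathrm{conv}(\{v\}\cup H_e)$ be its dual polytope. For a bounded domain $U\subset\mathbb R^d$ let $\mathcal V[U]$ be the set of vertices in $U$, let $\partial\mathcal V[U]$ be the set of the other vertices that share an edge with a vertex in $\mathcal V[U]$, let $\overline{\mathcal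 V[U]}=\mathcal V[U]\cup\partial\mathcal V[U]$ and $\widehat U=\bigcup_{v\in\overline{\mathcal V[U]}}P_v$. Let $\widehat U^{+}$ be the union of $\widehat U$ and of the sets $\mathrm{conv}(Q_e)$ for the edges $e$ with both end points in $\mathcal V[U]$. (Here $\mathrm{conv}(Q_e)=Q_e\subset\widehat U$ whenever the segment between the end points of $e$ meets $H_e$.) **Theorem.** Let $U\subset\mathbb R^d$ be a bounded domain and let $F,\alpha>0$. There is a constant $C=C(U,F,\alpha)\in(0,\infty)$ such that the following holds for every $\mathcal D$ and every orthogonal tiling of $\mathcal D$ as above with $\overline U\subset\mathcal D$ for which each $P_v$ with $v\in\mathcal V[U]$ lies in the interior of $\mathcal D$ and $$\mathrm{diam}(P_v)\le F\sup_{e=(w,v)\in\mathcal E}\mathrm{vol}_d(Q_e)^{\alpha}\qquad\text{for all }v\in\mathcal V[U].$$ Let $h_C$ be $C^2$ in a neighbourhood of $\widehat U^{+}$ with $\Delta h_C=0$ on $\widehat U$, and let $h_D:\overline{\mathcal V[U]}\to\mathbb R$ satisfy $$\Delta^{\mathcal G}_{\mathbf a}h_D=0\ \text{ in }\mathcal V[U],\qquad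 h_D=h_C\ \text{ on }\partial\mathcal V[U].$$ Put $\varepsilon=\sup_{v\in\overline{\mathcal V[U]}}\mathrm{diam}(P_v)$ and $M=\max\bigl(\sup_{\widehat U^{+}}|\nabla^2h_C|,1\bigr)$, where $|\cdot|$ is the operator norm. If $\varepsilon<(CM)^{-1}$, then $$\sup_{v\in\mathcal V[U]}|h_D(v)-h_C(v)|\le C\,M\,\varepsilon\,\log(\varepsilon^{-1}).$$ -/

import Mathlib

open MeasureTheory Set
open scoped InnerProductSpace

noncomputable section

/-- A tiling of a set `D ⊆ ℝ^d` by closed convex polytopes with disjoint interiors, each of them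
labelled by a vertex in its interior. The values of `tile` outside `verts` are irrelevant.
The polytopes cover `D`; they are allowed to reach outside of `D`. -/
structure Tiling (d : ℕ) (D : Set (EuclideanSpace ℝ (Fin d))) where
  /-- The set of vertices. -/
  verts : Set (EuclideanSpace ℝ (Fin d))
  /-- The polytope `P_v` of the vertex `v`. -/
  tile : EuclideanSpace ℝ (Fin d) → Set (EuclideanSpace ℝ (Fin d))
  isPolytope : ∀ v ∈ verts, ∃ s : Set (EuclideanSpace ℝ (Fin d)),
    s.Finite ∧ tile v = convexHull ℝ s
  mem_interior : ∀ v ∈ verts, v ∈ interior (tile v)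
  disjoint_interior : ∀ v ∈ verts, ∀ w ∈ verts, v ≠ w →
    Disjoint (interior (tile v)) (interior (tile w))
  cover : D ⊆ ⋃ v ∈ verts, tile v
  locallyFinite : ∀ K ⊆ D, IsCompact K → {v ∈ verts | (tile v ∩ K).Nonempty}.Finite

namespace Tiling

variable {d : ℕ} {D : Set (EuclideanSpace ℝ (Fin d))} (G : Tiling d D)

/-- The intersection `H_e = P_w ∩ P_v` of two tiles. -/
def facet (w v : EuclideanSpace ℝ (Fin d)) : Set (EuclideanSpace ℝ (Fin d)) :=
  G.tile w ∩ G.tile v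

/-- Two distinct vertices are joined by an edge if their tiles meet in a set of
dimension `d - 1`. -/
def Adj (w v : EuclideanSpace ℝ (Fin d)) : Prop :=
  w ∈ G.verts ∧ v ∈ G.verts ∧ w ≠ v ∧ (G.facet w v).Nonempty ∧
    Module.finrank ℝ (affineSpan ℝ (G.facet w v)).direction + 1 = d

/-- For each edge `(w, v)`, the vector `w - v` is orthogonal to the hyperplane containing
`P_w ∩ P_v`. -/
def IsOrthogonal : Prop :=
  ∀ w v, G.Adj w v → ∀ u ∈ (affineSpan ℝ (G.facet w v)).direction, ⟪w - v, u⟫_ℝ = 0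

/-- The conductance `vol_{d-1}(P_w ∩ P_v) / ‖w - v‖`. -/
def cond (w v : EuclideanSpace ℝ (Fin d)) : ℝ :=
  (μHE[d - 1]).real (G.facet w v) / ‖w - v‖

/-- The discrete Laplacian, `∑_{w ∼ v} a(w, v) (h w - h v)`. -/
def discreteLaplacian (h : EuclideanSpace ℝ (Fin d) → ℝ) (v : EuclideanSpace ℝ (Fin d)) : ℝ :=
  ∑ᶠ w ∈ {w | G.Adj w v}, G.cond w v * (h w - h v)

/-- The vertices `𝒱[U]` in the interior of `U`. -/
def vertsIn (U : Set (EuclideanSpace ℝ (Fin d))) : Set (EuclideanSpace ℝ (Fin d)) :=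
  G.verts ∩ interior U

/-- The boundary `∂𝒱[U]`: the vertices outside of `𝒱[U]` that share an edge with a vertex
in `𝒱[U]`. -/
def bdryVerts (U : Set (EuclideanSpace ℝ (Fin d))) : Set (EuclideanSpace ℝ (Fin d)) :=
  {w | w ∉ G.vertsIn U ∧ ∃ v ∈ G.vertsIn U, G.Adj w v}

/-- The closure `𝒱[U] ∪ ∂𝒱[U]`. -/
def closedVerts (U : Set (EuclideanSpace ℝ (Fin d))) : Set (EuclideanSpace ℝ (Fin d)) :=
  G.vertsIn U ∪ G.bdryVerts U

/-- The dual polytope `Q_e` of the edge `e = (w, v)`. -/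
def dualPolytope (w v : EuclideanSpace ℝ (Fin d)) : Set (EuclideanSpace ℝ (Fin d)) :=
  convexHull ℝ (insert w (G.facet w v)) ∪ convexHull ℝ (insert v (G.facet w v))

/-- The union `Û` of the tiles whose vertices lie in or are adjacent to `U`. -/
def hat (U : Set (EuclideanSpace ℝ (Fin d))) : Set (EuclideanSpace ℝ (Fin d)) :=
  ⋃ v ∈ G.closedVerts U, G.tile v

/-- The set `Û` together with the convex hulls of the dual polytopes `Q_e` of the edges `e` between
two vertices in `𝒱[U]`. The hull of `Q_e` differs from `Q_e ⊆ Û` only if the segment between the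
end points of `e` misses the facet `H_e`. -/
def hatHull (U : Set (EuclideanSpace ℝ (Fin d))) : Set (EuclideanSpace ℝ (Fin d)) :=
  G.hat U ∪ ⋃ w ∈ G.vertsIn U, ⋃ v ∈ G.vertsIn U, ⋃ _ : G.Adj w v,
    convexHull ℝ (G.dualPolytope w v)

/-- The mesh `ε`, the largest diameter of a tile with vertex in `𝒱[U] ∪ ∂𝒱[U]`. -/
def mesh (U : Set (EuclideanSpace ℝ (Fin d))) : ℝ :=
  sSup ((fun v => Metric.diam (G.tile v)) '' G.closedVerts U)

/-- The supremum of `vol_d(Q_e) ^ α` over the edges `e` incident to `v`. -/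
def maxDualVolume (α : ℝ) (v : EuclideanSpace ℝ (Fin d)) : ℝ :=
  sSup ((fun w => (volume.real (G.dualPolytope w v)) ^ α) '' {w | G.Adj w v})

end Tiling

/-- `M = (sup_K |∇² h|) ∨ 1`, with the operator norm of the second derivative. -/
def hessianBound {d : ℕ} (h : EuclideanSpace ℝ (Fin d) → ℝ)
    (K : Set (EuclideanSpace ℝ (Fin d))) : ℝ :=
  max (sSup ((fun x => ‖iteratedFDeriv ℝ 2 h x‖) '' K)) 1

end

/-! The error `f = h_D - h_C` vanishes at the boundary vertices. Orthogonality makes `w - v` normal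
to the facet of an edge, so the divergence theorem on a tile says that the fluxes of `∇h_C` through
its facets cancel. Hence the discrete Laplacian of `f` is the divergence of an antisymmetric flow
`θ`: up to sign, the difference between `a(w, v) (h_C w - h_C v)` and the flux (`sum_flowError`).
Between interior vertices Taylor's formula gives `|θ| ≤ a(w, v) ‖w - v‖ M max (r w) (r v)`, where
`r` is the diameter of a tile.

Let `g` be the discrete Green function with pole `z`. Then `f z` is a sum of `θ` against differences
of `g`. Plain Cauchy-Schwarz would need the energy of `g`, which is of order `g z` and has no
uniform bound. The energy is therefore replaced by the pairing of `g` with `ψ = (1 - (1 + g)^(-β)) /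
β`, which equals `2 ψ z ≤ 2 / β`. With `L = log ε⁻¹` and `β = 2α / L` this costs a single logarithm.
The price is a weight `1 + g` on the speed measure `m v = ∑ a(w, v) ‖w - v‖²` and a factor `(1 +
g)^(β / 2)` that `r` has to absorb.

Both prices can be paid. Linear functions are discrete harmonic, so the Laplacian of `‖x‖²` is `m`
and `∑ g m ≤ R²`. Moreover `a(w, v) ‖w - v‖²` is `d` times the volume of the two cones over the
facet, so `∑ m ≤ A` with `A` a multiple of the volume of a ball. Thus `m (1 + g) ≤ A + R²` at each
interior vertex, and the hypothesis on diameters gives `r ≤ B (1 + g)^(-α)`. Interpolation with `r ≤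
ε` yields `r ≤ e B ε (1 + g)^(-β / 2)`. Edges to the boundary need only `|θ| ≤ a M ε`, because the
flow of `g` into the boundary has total mass one.

The analytic estimate is `abs_le_of_networkLaplacian_eq_div`; its geometric input comes from
`integral_tile_fderiv`, `Adj.cond_mul_sq` and `sum_volume_cone_le`. -/

/-! ### Finite weighted networks: summation by parts, minimum principle, Green function -/

section Network

variable {ι : Type*} [Fintype ι]

/-- The Laplacian of a finite weighted network. -/
noncomputable def networkLaplacian (a : ι → ι → ℝ) (u : ι → ℝ) (v : ι) : ℝ :=
  ∑ w, a w v * (u w - u v)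

variable {a : ι → ι → ℝ}

theorem sum_mul_networkLaplacian (hsymm : ∀ v w, a v w = a w v) (u g : ι → ℝ) :
    ∑ v, u v * networkLaplacian a g v =
      -(1 / 2) * ∑ v, ∑ w, a w v * ((u w - u v) * (g w - g v)) := by
  have h1 : ∑ v, u v * networkLaplacian a g v = ∑ v, ∑ w, a w v * (u v * (g w - g v)) := by
    simp only [networkLaplacian, Finset.mul_sum]
    exact Finset.sum_congr rfl fun v _ => Finset.sum_congr rfl fun w _ => by ring
  have h2 : ∑ v, u v * networkLaplacian a g v = ∑ v, ∑ w, a w v * (u w * (g v - g w)) := by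
    rw [h1, Finset.sum_comm]
    exact Finset.sum_congr rfl fun v _ => Finset.sum_congr rfl fun w _ => by rw [hsymm v w]
  have h3 : ∑ v, ∑ w, a w v * ((u w - u v) * (g w - g v)) =
      -(∑ v, ∑ w, a w v * (u v * (g w - g v)) + ∑ v, ∑ w, a w v * (u w * (g v - g w))) := by
    rw [← Finset.sum_add_distrib, ← Finset.sum_neg_distrib]
    refine Finset.sum_congr rfl fun v _ => ?_
    rw [← Finset.sum_add_distrib, ← Finset.sum_neg_distrib]
    exact Finset.sum_congr rfl fun w _ => by ring
  rw [h3, ← h1, ← h2]; ring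

theorem sum_mul_networkLaplacian_comm (hsymm : ∀ v w, a v w = a w v) (u g : ι → ℝ) :
    ∑ v, u v * networkLaplacian a g v = ∑ v, g v * networkLaplacian a u v := by
  rw [sum_mul_networkLaplacian hsymm, sum_mul_networkLaplacian hsymm]
  congr 1
  exact Finset.sum_congr rfl fun v _ => Finset.sum_congr rfl fun w _ => by ring

variable {E : Type*} [NormedAddCommGroup E] [InnerProductSpace ℝ E]

/-- The speed measure `∑ a(w, v) ‖w - v‖²` of a network embedded in an inner product space. -/
noncomputable def speedMeasure (a : ι → ι → ℝ) (x : ι → E) (v : ι) : ℝ :=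
  ∑ w, a w v * ‖x w - x v‖ ^ 2

omit [InnerProductSpace ℝ E] in
theorem speedMeasure_nonneg (ha : ∀ v w, 0 ≤ a v w) (x : ι → E) (v : ι) :
    0 ≤ speedMeasure a x v :=
  Finset.sum_nonneg fun w _ => mul_nonneg (ha w v) (sq_nonneg _)

/-- Expand `‖x w‖² - ‖x v‖² = 2 ⟪x v, x w - x v⟫ + ‖x w - x v‖²`; harmonicity of the coordinates at
`v` kills the linear term. -/
theorem networkLaplacian_norm_sq {x : ι → E} {v : ι} (c : ℝ)
    (hlin : ∑ w, a w v • (x w - x v) = 0) :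
    networkLaplacian a (fun w => ‖x w‖ ^ 2 - c) v = speedMeasure a x v := by
  have h : ∑ w, a w v * (2 * ⟪x v, x w - x v⟫_ℝ) = 0 := by
    have := congrArg (fun y => 2 * ⟪x v, y⟫_ℝ) hlin
    simp only [inner_sum, inner_smul_right, inner_zero_right, mul_zero, Finset.mul_sum] at this
    rw [← this]
    exact Finset.sum_congr rfl fun w _ => by ring
  rw [networkLaplacian, speedMeasure, ← add_zero (∑ w, a w v * ‖x w - x v‖ ^ 2), ← h,
    ← Finset.sum_add_distrib]
  refine Finset.sum_congr rfl fun w _ => ?_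
  rw [← mul_add]
  congr 1
  rw [norm_sub_sq_real, inner_sub_right, real_inner_self_eq_norm_sq, real_inner_comm]
  ring

/-- A minimum principle that needs no connectedness. Subtracting a small multiple of `‖x‖² - R²`,
whose Laplacian on `V` is the positive speed measure, makes the Laplacian strictly negative and so
excludes a minimum in `V`. Then the multiple tends to zero. -/
theorem nonneg_of_networkLaplacian_nonpos {x : ι → E} {V : Finset ι} {R : ℝ}
    (ha : ∀ v w, 0 ≤ a v w) (hx : ∀ v, ‖x v‖ ≤ R)
    (hlin : ∀ v ∈ V, ∑ w, a w v • (x w - x v) = 0)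
    (hm : ∀ v ∈ V, 0 < speedMeasure a x v) {u : ι → ℝ}
    (hu : ∀ v ∈ V, networkLaplacian a u v ≤ 0) (hb : ∀ v ∉ V, 0 ≤ u v) (v : ι) : 0 ≤ u v := by
  have key : ∀ δ : ℝ, 0 < δ → -(δ * R ^ 2) ≤ u v := by
    intro δ hδ
    set q : ι → ℝ := fun w => ‖x w‖ ^ 2 - R ^ 2 with hq
    have hq0 : ∀ w, q w ≤ 0 := fun w => by
      simpa [hq] using pow_le_pow_left₀ (norm_nonneg _) (hx w) 2
    have : Nonempty ι := ⟨v⟩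
    obtain ⟨z, hz⟩ := Finite.exists_min (fun w => u w - δ * q w)
    have hzV : z ∉ V := by
      intro hzV
      have h1 : 0 ≤ networkLaplacian a (fun w => u w - δ * q w) z :=
        Finset.sum_nonneg fun w _ => mul_nonneg (ha w z) (sub_nonneg.2 (hz w))
      have h2 : networkLaplacian a (fun w => u w - δ * q w) z =
          networkLaplacian a u z - δ * networkLaplacian a q z := by
        simp only [networkLaplacian, Finset.mul_sum, ← Finset.sum_sub_distrib]
        exact Finset.sum_congr rfl fun w _ => by ring
      rw [h2, networkLaplacian_norm_sq _ (hlin z hzV)] at h1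
      have := mul_pos hδ (hm z hzV)
      linarith [hu z hzV]
    have h3 := hz v
    have h4 : 0 ≤ u z - δ * q z := by
      have := mul_nonneg hδ.le (neg_nonneg.2 (hq0 z))
      linarith [hb z hzV]
    have h5 : -(δ * R ^ 2) ≤ δ * q v := by
      have := mul_nonneg hδ.le (sq_nonneg ‖x v‖)
      simp only [hq, mul_sub]; linarith
    linarith
  by_contra! hneg
  have hR : 0 < R ^ 2 + 1 := by positivity
  -- This `δ` makes `δ * R ^ 2` at most half of `-(u v)`.
  have := key (-(u v) / (2 * (R ^ 2 + 1))) (by apply div_pos <;> linarith)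
  have h6 : -(u v) / (2 * (R ^ 2 + 1)) * R ^ 2 ≤ -(u v) / 2 := by
    rw [div_mul_eq_mul_div, div_le_div_iff₀ (by positivity) (by norm_num)]
    nlinarith
  linarith

/-- The Dirichlet problem is a linear endomorphism of a finite-dimensional space. The minimum
principle makes it injective, hence surjective, and also gives the sign of the solution. -/
theorem exists_green {x : ι → E} {V : Finset ι} {R : ℝ}
    (ha : ∀ v w, 0 ≤ a v w) (hx : ∀ v, ‖x v‖ ≤ R)
    (hlin : ∀ v ∈ V, ∑ w, a w v • (x w - x v) = 0)
    (hm : ∀ v ∈ V, 0 < speedMeasure a x v) [DecidableEq ι] (z : ι) :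
    ∃ g : ι → ℝ, (∀ v, 0 ≤ g v) ∧ (∀ v ∉ V, g v = 0) ∧
      ∀ v ∈ V, networkLaplacian a g v = if v = z then -1 else 0 := by
  let T : (ι → ℝ) →ₗ[ℝ] (ι → ℝ) :=
    { toFun := fun u v => if v ∈ V then networkLaplacian a u v else u v
      map_add' := fun u u' => by
        ext v
        simp only [networkLaplacian, Pi.add_apply]
        split_ifs
        · rw [← Finset.sum_add_distrib]
          exact Finset.sum_congr rfl fun w _ => by ring
        · rfl
      map_smul' := fun c u => by
        ext v
        simp only [networkLaplacian, Pi.smul_apply, smul_eq_mul, RingHom.id_apply]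
        split_ifs
        · rw [Finset.mul_sum]
          exact Finset.sum_congr rfl fun w _ => by ring
        · rfl }
  have hT : ∀ u v, T u v = if v ∈ V then networkLaplacian a u v else u v := fun _ _ => rfl
  have hnn : ∀ u : ι → ℝ, (∀ v ∈ V, T u v ≤ 0) → (∀ v ∉ V, 0 ≤ T u v) → ∀ v, 0 ≤ u v := by
    intro u h1 h2
    refine nonneg_of_networkLaplacian_nonpos ha hx hlin hm (fun v hv => ?_) (fun v hv => ?_)
    · simpa [hT, hv] using h1 v hv
    · simpa [hT, hv] using h2 v hv
  have hinj : Function.Injective T := by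
    rw [← LinearMap.ker_eq_bot, LinearMap.ker_eq_bot']
    intro u hu
    ext v
    have h1 := hnn u (by simp [hu]) (by simp [hu]) v
    have h2 := hnn (-u) (by simp [hu]) (by simp [hu]) v
    simp only [Pi.neg_apply] at h2
    simp only [Pi.zero_apply]
    linarith
  obtain ⟨g, hg⟩ := LinearMap.injective_iff_surjective.1 hinj
    (fun v => if v ∈ V then (if v = z then -1 else 0) else 0)
  refine ⟨g, hnn g (fun v hv => ?_) (fun v hv => ?_), fun v hv => ?_, fun v hv => ?_⟩
  · rw [hg]; simp only [hv, if_true]; split_ifs <;> norm_num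
  · rw [hg]; simp [hv]
  · have := congrFun hg v; simpa [hT, hv] using this
  · have := congrFun hg v; simpa [hT, hv] using this

end Network

/-! ### Inequalities for powers -/

/-- Bernoulli's inequality for `(X / Y) ^ β`, multiplied by `X ^ (-β)`. With `X` and `Y` the values
of `1 + g` at the ends of an edge, the right side is the increment of `ψ`. -/
theorem sub_mul_le_rpow_sub_rpow {X Y β : ℝ} (hX : 0 < X) (hXY : X ≤ Y) (hβ : 0 < β)
    (hβ1 : β ≤ 1) : X ^ (-β) * ((Y - X) / Y) ≤ (X ^ (-β) - Y ^ (-β)) / β := by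
  have hY : 0 < Y := hX.trans_le hXY
  have h := rpow_one_add_le_one_add_mul_self (s := X / Y - 1)
    (by have := div_pos hX hY; linarith) hβ.le hβ1
  rw [add_sub_cancel, Real.div_rpow hX.le hY.le] at h
  have e1 : Y ^ (-β) = X ^ (-β) * (X ^ β / Y ^ β) := by
    rw [Real.rpow_neg hX.le, Real.rpow_neg hY.le]
    field_simp
  rw [e1, le_div_iff₀ hβ, sub_div, div_self hY.ne']
  have := mul_le_mul_of_nonneg_left h (Real.rpow_nonneg hX.le (-β))
  nlinarith

/-- Interpolation between a uniform bound and a power-law bound. -/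
theorem le_mul_rpow_of_le_of_le {ε L r B α X : ℝ} (hL : 1 ≤ L) (hε : ε = Real.exp (-L))
    (hr0 : 0 ≤ r) (hrε : r ≤ ε) (hB : 1 ≤ B) (hX : 0 < X) (hrX : r ≤ B * X ^ (-α)) :
    r ≤ Real.exp 1 * B * ε * X ^ (-(α / L)) := by
  have hL0 : 0 < L := by linarith
  have hX' : 0 < X ^ (-α) := Real.rpow_pos_of_pos hX _
  have hs0 : 0 ≤ 1 / L := by positivity
  have hs1 : 1 / L ≤ 1 := by rw [div_le_one hL0]; exact hL
  have hε0 : 0 < ε := by rw [hε]; exact Real.exp_pos _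
  -- Only the fraction `1 / L` of the exponent is spent on the power law. Since `ε = exp (-L)`, the
  -- loss is the constant `ε ^ (-1 / L) = e`.
  have h1 : r = r ^ (1 - 1 / L) * r ^ (1 / L) := by
    rw [← Real.rpow_add' hr0 (by norm_num)]; norm_num
  have h2 : r ^ (1 - 1 / L) ≤ Real.exp 1 * ε := by
    calc r ^ (1 - 1 / L) ≤ ε ^ (1 - 1 / L) := Real.rpow_le_rpow hr0 hrε (by linarith)
      _ = Real.exp 1 * ε := by
        rw [hε, ← Real.exp_mul, ← Real.exp_add]
        congr 1
        field_simp
        ring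
  have h3 : r ^ (1 / L) ≤ B * X ^ (-(α / L)) := by
    calc r ^ (1 / L) ≤ (B * X ^ (-α)) ^ (1 / L) := Real.rpow_le_rpow hr0 hrX hs0
      _ = B ^ (1 / L) * X ^ (-(α / L)) := by
        rw [Real.mul_rpow (by linarith) hX'.le, ← Real.rpow_mul hX.le]
        congr 2
        ring
      _ ≤ B * X ^ (-(α / L)) := by
        gcongr
        simpa using Real.rpow_le_rpow_of_exponent_le hB hs1
  rw [h1]
  calc _ ≤ (Real.exp 1 * ε) * (B * X ^ (-(α / L))) := by
        apply mul_le_mul h2 h3 (Real.rpow_nonneg hr0 _) (by positivity)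
    _ = _ := by ring

/-- Young's inequality with weight `Y`. The first term is an edge's share of the speed measure
weighted by `1 + g v + g w`, where `X ≥ 1` permits the symmetric weight; the second is its share of
the pairing of `g` with `ψ`. -/
theorem mul_mul_sub_le {ε X Y β r D k : ℝ} (hε : 0 < ε) (hX : 1 ≤ X) (hXY : X ≤ Y) (hβ : 0 < β)
    (hβ1 : β ≤ 1) (hr0 : 0 ≤ r) (hr : r ≤ k * ε * X ^ (-(β / 2))) :
    D * r * (Y - X) ≤ ε / 2 * (D ^ 2 * (X + Y - 1)) +
      k ^ 2 * ε / 2 * ((Y - X) * ((X ^ (-β) - Y ^ (-β)) / β)) := by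
  have hX0 : 0 < X := by linarith
  have hY : 0 < Y := by linarith
  have h1 := sub_mul_le_rpow_sub_rpow hX0 hXY hβ hβ1
  have h2 : r ^ 2 ≤ k ^ 2 * ε ^ 2 * X ^ (-β) := by
    have := pow_le_pow_left₀ hr0 hr 2
    rw [mul_pow, mul_pow, ← Real.rpow_natCast (X ^ (-(β / 2))), ← Real.rpow_mul hX0.le] at this
    have e : -(β / 2) * ((2 : ℕ) : ℝ) = -β := by push_cast; ring
    rwa [e] at this
  have h3 : D * r * (Y - X) ≤ ε / 2 * (D ^ 2 * Y) + r ^ 2 * ((Y - X) * ((Y - X) / Y)) / (2 * ε) := by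
    have : 0 ≤ (ε * D * Y - r * (Y - X)) ^ 2 / (2 * ε * Y) := by positivity
    have e : (ε * D * Y - r * (Y - X)) ^ 2 / (2 * ε * Y) = ε / 2 * (D ^ 2 * Y) +
        r ^ 2 * ((Y - X) * ((Y - X) / Y)) / (2 * ε) - D * r * (Y - X) := by
      field_simp; ring
    linarith
  have h4 : r ^ 2 * ((Y - X) * ((Y - X) / Y)) / (2 * ε) ≤
      k ^ 2 * ε / 2 * ((Y - X) * ((X ^ (-β) - Y ^ (-β)) / β)) := by
    rw [div_le_iff₀ (by positivity)]
    have hd : 0 ≤ (Y - X) * ((Y - X) / Y) :=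
      mul_nonneg (by linarith) (div_nonneg (by linarith) hY.le)
    calc r ^ 2 * ((Y - X) * ((Y - X) / Y)) ≤
        k ^ 2 * ε ^ 2 * X ^ (-β) * ((Y - X) * ((Y - X) / Y)) :=
          mul_le_mul_of_nonneg_right h2 hd
      _ = k ^ 2 * ε ^ 2 * ((Y - X) * (X ^ (-β) * ((Y - X) / Y))) := by ring
      _ ≤ k ^ 2 * ε ^ 2 * ((Y - X) * ((X ^ (-β) - Y ^ (-β)) / β)) := by
          have : 0 ≤ Y - X := by linarith
          gcongr
      _ = _ := by ring
  have h5 : ε / 2 * (D ^ 2 * Y) ≤ ε / 2 * (D ^ 2 * (X + Y - 1)) := by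
    gcongr; linarith
  linarith

/-! ### The sup bound on a network -/

section NetworkEstimate

variable {ι : Type*} [Fintype ι] [DecidableEq ι] {E : Type*} [NormedAddCommGroup E]
  [InnerProductSpace ℝ E]

/-- The sup bound for functions on a finite network which vanish on the boundary and whose
Laplacian is the divergence of a small flow. -/
theorem abs_le_of_networkLaplacian_eq_div {a : ι → ι → ℝ} {x : ι → E} {V : Finset ι}
    {R A F α ε L M : ℝ} {r f : ι → ℝ} {θ : ι → ι → ℝ}
    (hsymm : ∀ v w, a v w = a w v) (ha : ∀ v w, 0 ≤ a v w) (hx : ∀ v, ‖x v‖ ≤ R)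
    (hlin : ∀ v ∈ V, ∑ w, a w v • (x w - x v) = 0)
    (hm : ∀ v ∈ V, 0 < speedMeasure a x v) (hA : ∑ v ∈ V, speedMeasure a x v ≤ A)
    (hF : 0 < F) (hα : 0 < α) (hL : 1 ≤ L) (hLα : 2 * α ≤ L) (hε : ε = Real.exp (-L))
    (hM : 0 ≤ M) (hr0 : ∀ v, 0 ≤ r v) (hrε : ∀ v, r v ≤ ε)
    (hrF : ∀ v ∈ V, r v ≤ F * speedMeasure a x v ^ α)
    (hf : ∀ v ∉ V, f v = 0) (hθf : ∀ v ∈ V, networkLaplacian a f v = ∑ w, θ w v)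
    (hθ : ∀ v ∈ V, ∀ w ∈ V, θ w v = -θ v w)
    (hθV : ∀ v ∈ V, ∀ w ∈ V, |θ w v| ≤ a w v * ‖x w - x v‖ * (M * max (r w) (r v)))
    (hθB : ∀ v ∈ V, ∀ w ∉ V, |θ w v| ≤ a w v * (M * ε)) {z : ι} (hz : z ∈ V) :
    |f z| ≤ (A + 2 * R ^ 2 + (Real.exp 1 * max 1 (F * (A + R ^ 2) ^ α)) ^ 2 / α + 1) *
      M * (ε * L) := by
  obtain ⟨g, hg0, hgV, hg⟩ := exists_green ha hx hlin hm z
  have hL0 : 0 < L := by linarith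
  have hε0 : 0 < ε := by rw [hε]; exact Real.exp_pos _
  have hm0 := speedMeasure_nonneg ha x
  have hA0 : 0 ≤ A := (Finset.sum_nonneg fun v _ => hm0 v).trans hA
  set B := max 1 (F * (A + R ^ 2) ^ α) with hB
  have hB1 : 1 ≤ B := le_max_left _ _
  -- The Laplacian of `g` is nonnegative on the boundary.
  have hgB : ∀ v ∉ V, 0 ≤ networkLaplacian a g v := fun v hv =>
    Finset.sum_nonneg fun w _ => mul_nonneg (ha w v) (by rw [hgV v hv, sub_zero]; exact hg0 w)
  have hsum : ∀ u : ι → ℝ, ∑ v, u v * networkLaplacian a g v =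
      -u z + ∑ v ∈ Vᶜ, u v * networkLaplacian a g v := by
    intro u
    rw [← Finset.sum_add_sum_compl V]
    congr 1
    rw [Finset.sum_congr rfl (fun v hv => by rw [hg v hv])]
    simp [hz]
  have hgsum : ∀ u : ι → ℝ, ∑ v, g v * u v = ∑ v ∈ V, g v * u v := by
    intro u
    rw [← Finset.sum_add_sum_compl V]
    simp only [add_eq_left]
    exact Finset.sum_eq_zero fun v hv => by rw [hgV v (Finset.mem_compl.1 hv), zero_mul]
  -- The total flow out of the boundary is one.
  have hflow : ∑ v ∈ Vᶜ, networkLaplacian a g v = 1 := by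
    have h1 := hsum (fun _ => 1)
    rw [sum_mul_networkLaplacian hsymm] at h1
    simp at h1
    linarith
  -- The Green function is integrable against the speed measure.
  have hmg : ∑ v ∈ V, g v * speedMeasure a x v ≤ R ^ 2 := by
    have h1 := hsum (fun w => ‖x w‖ ^ 2 - R ^ 2)
    rw [sum_mul_networkLaplacian_comm hsymm, hgsum,
      Finset.sum_congr rfl (fun v hv => by rw [networkLaplacian_norm_sq _ (hlin v hv)])] at h1
    rw [h1]
    have h2 : ∑ v ∈ Vᶜ, (‖x v‖ ^ 2 - R ^ 2) * networkLaplacian a g v ≤ 0 :=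
      Finset.sum_nonpos fun v hv => mul_nonpos_of_nonpos_of_nonneg
        (sub_nonpos.2 (pow_le_pow_left₀ (norm_nonneg _) (hx v) 2))
        (hgB v (Finset.mem_compl.1 hv))
    have := sq_nonneg ‖x z‖
    linarith
  -- A single vertex contributes no more than the total mass, so a large value of `g` forces a small
  -- speed measure.
  have hmg1 : ∀ v ∈ V, speedMeasure a x v * (1 + g v) ≤ A + R ^ 2 := by
    intro v hv
    have h1 := Finset.single_le_sum (fun w _ => hm0 w) hv
    have h2 := Finset.single_le_sum
      (f := fun w => g w * speedMeasure a x w) (fun w _ => mul_nonneg (hg0 w) (hm0 w)) hv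
    linarith
  -- The decay `(1 + g) ^ (-α / L)` produced by the interpolation is `(1 + g) ^ (-β / 2)`, which is
  -- what Young's inequality consumes.
  set β := 2 * α / L with hβ
  have hβ0 : 0 < β := by positivity
  have hβ1 : β ≤ 1 := by rw [hβ, div_le_one hL0]; exact hLα
  have hrg : ∀ v, r v ≤ Real.exp 1 * B * ε * (1 + g v) ^ (-(β / 2)) := by
    intro v
    have hg1 : 0 < 1 + g v := by linarith [hg0 v]
    have e : β / 2 = α / L := by rw [hβ]; ring
    rw [e]
    refine le_mul_rpow_of_le_of_le hL hε (hr0 v) (hrε v) hB1 hg1 ?_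
    by_cases hv : v ∈ V
    · refine (hrF v hv).trans ?_
      have h1 : speedMeasure a x v ≤ (A + R ^ 2) / (1 + g v) := by
        rw [le_div_iff₀ hg1]; exact hmg1 v hv
      calc F * speedMeasure a x v ^ α ≤ F * ((A + R ^ 2) / (1 + g v)) ^ α := by
            gcongr
            exact hm0 v
        _ = F * (A + R ^ 2) ^ α * (1 + g v) ^ (-α) := by
            rw [Real.div_rpow (by positivity) hg1.le, Real.rpow_neg hg1.le]; ring
        _ ≤ B * (1 + g v) ^ (-α) := by gcongr; exact le_max_right _ _
    · rw [hgV v hv]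
      simp only [add_zero, Real.one_rpow, mul_one]
      refine (hrε v).trans ?_
      rw [hε]
      exact (Real.exp_le_one_iff.2 (by linarith)).trans hB1
  -- A bounded substitute for `log (1 + g)`, its limit as `β → 0`: it is increasing in `g`, zero on
  -- the boundary and at most `1 / β`.
  set ψ : ι → ℝ := fun v => (1 - (1 + g v) ^ (-β)) / β with hψ
  have hψB : ∀ v ∉ V, ψ v = 0 := fun v hv => by simp [hψ, hgV v hv]
  have hψ1 : ψ z ≤ L / (2 * α) := by
    have h1 : 0 ≤ (1 + g z) ^ (-β) := Real.rpow_nonneg (by linarith [hg0 z]) _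
    calc ψ z ≤ 1 / β := by simp only [hψ]; gcongr; linarith
      _ = L / (2 * α) := by rw [hβ, one_div_div]
  have hψmono : ∀ v w, 0 ≤ (g v - g w) * (ψ v - ψ w) := by
    intro v w
    have aux : ∀ v w, g w ≤ g v → ψ w ≤ ψ v := by
      intro v w h
      simp only [hψ]
      gcongr 2
      exact Real.rpow_le_rpow_of_nonpos (by linarith [hg0 w]) (by linarith) (by linarith)
    rcases le_total (g w) (g v) with h | h
    · exact mul_nonneg (by linarith) (by linarith [aux v w h])
    · exact mul_nonneg_of_nonpos_of_nonpos (by linarith) (by linarith [aux w v h])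
  have hedge : ∀ v ∈ V, ∀ w ∈ V, |(g v - g w) * θ w v| ≤
      M * (a w v * (ε / 2 * (‖x w - x v‖ ^ 2 * (1 + g v + g w)) +
        (Real.exp 1 * B) ^ 2 * ε / 2 * ((g v - g w) * (ψ v - ψ w)))) := by
    -- The decay bound is weaker where `g` is smaller, so the one at `w` covers `r` at both ends and
    -- hence their maximum.
    have aux : ∀ v w, g w ≤ g v → ∀ s ∈ ({r v, r w} : Set ℝ),
        ‖x w - x v‖ * s * (g v - g w) ≤
        ε / 2 * (‖x w - x v‖ ^ 2 * (1 + g v + g w)) +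
        (Real.exp 1 * B) ^ 2 * ε / 2 * ((g v - g w) * (ψ v - ψ w)) := by
      intro v w h s hs
      have hgw : 0 < 1 + g w := by linarith [hg0 w]
      have hs0 : 0 ≤ s := by rcases hs with rfl | rfl <;> exact hr0 _
      have hsle : s ≤ Real.exp 1 * B * ε * (1 + g w) ^ (-(β / 2)) := by
        rcases hs with rfl | rfl
        · refine (hrg v).trans ?_
          refine mul_le_mul_of_nonneg_left ?_ (by positivity)
          exact Real.rpow_le_rpow_of_nonpos hgw (by linarith) (by linarith)
        · exact hrg w
      have := mul_mul_sub_le (D := ‖x w - x v‖) hε0 (by linarith [hg0 w] : 1 ≤ 1 + g w)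
        (by linarith : 1 + g w ≤ 1 + g v) hβ0 hβ1 hs0 hsle
      have e1 : 1 + g v - (1 + g w) = g v - g w := by ring
      have e2 : 1 + g w + (1 + g v) - 1 = 1 + g v + g w := by ring
      have e3 : ψ v - ψ w = ((1 + g w) ^ (-β) - (1 + g v) ^ (-β)) / β := by
        simp only [hψ]; ring
      rw [e1, e2] at this
      rw [e3]
      exact this
    intro v hv w hw
    have aux2 : ‖x w - x v‖ * max (r w) (r v) * |g v - g w| ≤
        ε / 2 * (‖x w - x v‖ ^ 2 * (1 + g v + g w)) +
        (Real.exp 1 * B) ^ 2 * ε / 2 * ((g v - g w) * (ψ v - ψ w)) := by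
      rcases le_total (g w) (g v) with h | h
      · rw [abs_of_nonneg (by linarith)]
        apply aux v w h
        rcases max_choice (r w) (r v) with h | h <;> simp [h]
      · rw [abs_of_nonpos (by linarith)]
        have := aux w v h (max (r w) (r v))
          (by rcases max_choice (r w) (r v) with h | h <;> simp [h])
        rw [norm_sub_rev (x v) (x w)] at this
        convert this using 1
        · ring
        · ring
    rw [abs_mul]
    calc |g v - g w| * |θ w v| ≤ |g v - g w| * (a w v * ‖x w - x v‖ * (M * max (r w) (r v))) := by
          gcongr; exact hθV v hv w hw
      _ = M * (a w v * (‖x w - x v‖ * max (r w) (r v) * |g v - g w|)) := by ring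
      _ ≤ _ := by have := ha w v; gcongr
  -- Green's identity represents `f z`.
  have hrep : -f z = (1 / 2) * ∑ v ∈ V, ∑ w ∈ V, (g v - g w) * θ w v +
      ∑ v ∈ V, ∑ w ∈ Vᶜ, g v * θ w v := by
    have h1 := hsum f
    rw [Finset.sum_eq_zero (s := Vᶜ) (fun v hv => by rw [hf v (Finset.mem_compl.1 hv), zero_mul]),
      add_zero, sum_mul_networkLaplacian_comm hsymm, hgsum] at h1
    rw [← h1]
    have h2 : ∑ v ∈ V, g v * networkLaplacian a f v =
        ∑ v ∈ V, ∑ w ∈ V, g v * θ w v + ∑ v ∈ V, ∑ w ∈ Vᶜ, g v * θ w v := by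
      rw [← Finset.sum_add_distrib]
      refine Finset.sum_congr rfl fun v hv => ?_
      rw [hθf v hv, Finset.mul_sum, Finset.sum_add_sum_compl]
    rw [h2]
    congr 1
    have h3 : ∑ v ∈ V, ∑ w ∈ V, g v * θ w v = -∑ v ∈ V, ∑ w ∈ V, g w * θ w v := by
      rw [Finset.sum_comm, ← Finset.sum_neg_distrib]
      refine Finset.sum_congr rfl fun v hv => ?_
      rw [← Finset.sum_neg_distrib]
      refine Finset.sum_congr rfl fun w hw => ?_
      rw [hθ w hw v hv]; ring
    simp only [sub_mul, Finset.sum_sub_distrib]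
    linarith
  -- On an edge to the boundary `a v w * g v` is the flow of `g` through it, and these flows add up
  -- to at most one.
  have hsecond : |∑ v ∈ V, ∑ w ∈ Vᶜ, g v * θ w v| ≤ M * ε := by
    calc |∑ v ∈ V, ∑ w ∈ Vᶜ, g v * θ w v| ≤ ∑ v ∈ V, ∑ w ∈ Vᶜ, |g v * θ w v| :=
          (Finset.abs_sum_le_sum_abs _ _).trans
            (Finset.sum_le_sum fun v _ => Finset.abs_sum_le_sum_abs _ _)
      _ ≤ ∑ v ∈ V, ∑ w ∈ Vᶜ, (M * ε) * (a v w * (g v - g w)) := by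
          refine Finset.sum_le_sum fun v hv => Finset.sum_le_sum fun w hw => ?_
          have hw' := Finset.mem_compl.1 hw
          rw [abs_mul, abs_of_nonneg (hg0 v), hgV w hw', sub_zero]
          calc g v * |θ w v| ≤ g v * (a w v * (M * ε)) := by
                gcongr
                · exact hg0 v
                · exact hθB v hv w hw'
            _ = _ := by rw [hsymm w v]; ring
      _ = (M * ε) * ∑ w ∈ Vᶜ, ∑ v ∈ V, a v w * (g v - g w) := by
          rw [Finset.sum_comm, Finset.mul_sum]
          exact Finset.sum_congr rfl fun w _ => by rw [Finset.mul_sum]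
      _ ≤ (M * ε) * ∑ w ∈ Vᶜ, networkLaplacian a g w := by
          gcongr with w hw
          refine Finset.sum_le_sum_of_subset_of_nonneg (Finset.subset_univ _) fun v _ _ => ?_
          rw [hgV w (Finset.mem_compl.1 hw), sub_zero]
          exact mul_nonneg (ha v w) (hg0 v)
      _ = M * ε := by rw [hflow, mul_one]
  have hT1 : ∑ v ∈ V, ∑ w ∈ V, a w v * (‖x w - x v‖ ^ 2 * (1 + g v + g w)) ≤ A + 2 * R ^ 2 := by
    have h1 : ∀ u : ι → ℝ, (∀ v, 0 ≤ u v) → ∑ v ∈ V, ∑ w ∈ V, a w v * (‖x w - x v‖ ^ 2 * u v) ≤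
        ∑ v ∈ V, u v * speedMeasure a x v := by
      intro u hu
      refine Finset.sum_le_sum fun v _ => ?_
      rw [speedMeasure, Finset.mul_sum]
      calc ∑ w ∈ V, a w v * (‖x w - x v‖ ^ 2 * u v) =
          ∑ w ∈ V, u v * (a w v * ‖x w - x v‖ ^ 2) :=
            Finset.sum_congr rfl fun w _ => by ring
        _ ≤ _ := Finset.sum_le_sum_of_subset_of_nonneg (Finset.subset_univ _) fun w _ _ =>
            mul_nonneg (hu v) (mul_nonneg (ha w v) (sq_nonneg _))
    have h2 := h1 (fun _ => 1) (fun _ => zero_le_one)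
    have h3 := h1 g hg0
    have h4 : ∑ v ∈ V, ∑ w ∈ V, a w v * (‖x w - x v‖ ^ 2 * g w) =
        ∑ v ∈ V, ∑ w ∈ V, a w v * (‖x w - x v‖ ^ 2 * g v) := by
      rw [Finset.sum_comm]
      exact Finset.sum_congr rfl fun v _ => Finset.sum_congr rfl fun w _ => by
        rw [hsymm v w, norm_sub_rev]
    have h5 : ∑ v ∈ V, ∑ w ∈ V, a w v * (‖x w - x v‖ ^ 2 * (1 + g v + g w)) =
        ∑ v ∈ V, ∑ w ∈ V, a w v * (‖x w - x v‖ ^ 2 * 1) +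
        ∑ v ∈ V, ∑ w ∈ V, a w v * (‖x w - x v‖ ^ 2 * g v) +
        ∑ v ∈ V, ∑ w ∈ V, a w v * (‖x w - x v‖ ^ 2 * g w) := by
      simp only [← Finset.sum_add_distrib, ← mul_add]
    simp only [one_mul] at h2
    rw [h5, h4]
    linarith
  -- Testing the equation of `g` against `ψ` evaluates the sum over all ordered pairs to `2 ψ z`;
  -- monotonicity of `ψ` in `g` allows the restriction to `V`.
  have hT2 : ∑ v ∈ V, ∑ w ∈ V, a w v * ((g v - g w) * (ψ v - ψ w)) ≤ L / α := by
    have h1 := hsum ψ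
    rw [Finset.sum_eq_zero (s := Vᶜ) (fun v hv => by rw [hψB v (Finset.mem_compl.1 hv), zero_mul]),
      add_zero, sum_mul_networkLaplacian hsymm] at h1
    have h2 : ∑ v ∈ V, ∑ w ∈ V, a w v * ((g v - g w) * (ψ v - ψ w)) ≤
        ∑ v, ∑ w, a w v * ((ψ w - ψ v) * (g w - g v)) := by
      have h3 : ∀ v w, 0 ≤ a w v * ((g v - g w) * (ψ v - ψ w)) := fun v w =>
        mul_nonneg (ha w v) (hψmono v w)
      calc _ ≤ ∑ v, ∑ w, a w v * ((g v - g w) * (ψ v - ψ w)) :=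
            (Finset.sum_le_sum fun v _ => Finset.sum_le_sum_of_subset_of_nonneg
              (Finset.subset_univ _) fun w _ _ => h3 v w).trans
            (Finset.sum_le_sum_of_subset_of_nonneg (Finset.subset_univ _) fun v _ _ =>
              Finset.sum_nonneg fun w _ => h3 v w)
        _ = _ := Finset.sum_congr rfl fun v _ => Finset.sum_congr rfl fun w _ => by ring
    have e : L / α = 2 * (L / (2 * α)) := by field_simp
    linarith
  have hfirst : |∑ v ∈ V, ∑ w ∈ V, (g v - g w) * θ w v| ≤
      M * (ε / 2 * (A + 2 * R ^ 2) + (Real.exp 1 * B) ^ 2 * ε / 2 * (L / α)) := by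
    calc |∑ v ∈ V, ∑ w ∈ V, (g v - g w) * θ w v| ≤ ∑ v ∈ V, ∑ w ∈ V, |(g v - g w) * θ w v| :=
          (Finset.abs_sum_le_sum_abs _ _).trans
            (Finset.sum_le_sum fun v _ => Finset.abs_sum_le_sum_abs _ _)
      _ ≤ ∑ v ∈ V, ∑ w ∈ V, M * (a w v * (ε / 2 * (‖x w - x v‖ ^ 2 * (1 + g v + g w)) +
        (Real.exp 1 * B) ^ 2 * ε / 2 * ((g v - g w) * (ψ v - ψ w)))) :=
          Finset.sum_le_sum fun v hv => Finset.sum_le_sum fun w hw => hedge v hv w hw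
      _ = M * (ε / 2 * ∑ v ∈ V, ∑ w ∈ V, a w v * (‖x w - x v‖ ^ 2 * (1 + g v + g w)) +
          (Real.exp 1 * B) ^ 2 * ε / 2 *
            ∑ v ∈ V, ∑ w ∈ V, a w v * ((g v - g w) * (ψ v - ψ w))) := by
          simp only [Finset.mul_sum, ← Finset.sum_add_distrib]
          exact Finset.sum_congr rfl fun v _ => Finset.sum_congr rfl fun w _ => by ring
      _ ≤ _ := by gcongr
  have hfinal : |f z| ≤ (1 / 2) * (M * (ε / 2 * (A + 2 * R ^ 2) +
      (Real.exp 1 * B) ^ 2 * ε / 2 * (L / α))) + M * ε := by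
    rw [← abs_neg, hrep]
    refine (abs_add_le _ _).trans ?_
    rw [abs_mul, abs_of_pos (by norm_num : (0 : ℝ) < 1 / 2)]
    linarith
  refine hfinal.trans ?_
  have hMe : 0 ≤ M * ε := by positivity
  have k1 : (M * ε) * (A + 2 * R ^ 2) ≤ (M * ε) * (A + 2 * R ^ 2) * L :=
    le_mul_of_one_le_right (by positivity) hL
  have k2 : M * ε ≤ M * ε * L := le_mul_of_one_le_right hMe hL
  have k3 : 0 ≤ (M * ε) * ((Real.exp 1 * B) ^ 2 * (L / α)) := by positivity
  have e : (A + 2 * R ^ 2 + (Real.exp 1 * B) ^ 2 / α + 1) * M * (ε * L) =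
      (M * ε) * (A + 2 * R ^ 2) * L + (M * ε) * ((Real.exp 1 * B) ^ 2 * (L / α)) + M * ε * L := by
    ring
  rw [e]
  have k4 : 0 ≤ (M * ε) * (A + 2 * R ^ 2) := by positivity
  linarith

end NetworkEstimate

/-! ### Coordinates along a hyperplane, Hausdorff measure and null sets -/

theorem volume_setOf_linearMap_eq {F : Type*} [NormedAddCommGroup F] [InnerProductSpace ℝ F]
    [FiniteDimensional ℝ F] [MeasurableSpace F] [BorelSpace F] {l : F →ₗ[ℝ] ℝ} (hl : l ≠ 0)
    (c : ℝ) : volume {x | l x = c} = 0 := by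
  let s : AffineSubspace ℝ F :=
    { carrier := {x | l x = c}
      smul_vsub_vadd_mem' := by
        intro t x y z hx hy hz
        simp only [mem_ofPred_eq] at hx hy hz ⊢
        simp [hx, hy, hz] }
  refine Measure.addHaar_affineSubspace volume s fun hs => hl ?_
  have h : ∀ x, l x = c := fun x => by
    have : x ∈ s := by rw [hs]; trivial
    exact this
  ext x
  have h0 := h 0
  rw [map_zero] at h0
  rw [h x, ← h0]; rfl

section Hyperplane

variable {k : ℕ}

/-- An orthonormal basis of the orthogonal complement of `n` gives `A`. Volume is preserved because
the orthogonal decomposition is isometric; this is what allows Fubini along `n`. -/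
theorem exists_hyperplane_coordinates {n : EuclideanSpace ℝ (Fin (k + 1))} (hn : ‖n‖ = 1) :
    ∃ A : EuclideanSpace ℝ (Fin k) →ₗᵢ[ℝ] EuclideanSpace ℝ (Fin (k + 1)),
      (∀ x, ⟪n, x⟫_ℝ = 0 ↔ x ∈ range A) ∧
      MeasurePreserving (fun p : EuclideanSpace ℝ (Fin k) × ℝ => A p.1 + p.2 • n) := by
  have hn0 : n ≠ 0 := by rintro rfl; simp at hn
  have : Fact (Module.finrank ℝ (EuclideanSpace ℝ (Fin (k + 1))) = k + 1) := ⟨by simp⟩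
  have hrank : Module.finrank ℝ (ℝ ∙ n)ᗮ = k := Submodule.finrank_orthogonal_span_singleton hn0
  let B : EuclideanSpace ℝ (Fin k) ≃ₗᵢ[ℝ] (ℝ ∙ n)ᗮ :=
    ((stdOrthonormalBasis ℝ (ℝ ∙ n)ᗮ).reindex (finCongr hrank)).repr.symm
  refine ⟨(ℝ ∙ n)ᗮ.subtypeₗᵢ.comp B.toLinearIsometry, fun x => ?_, ?_⟩
  · rw [← Submodule.mem_orthogonal_singleton_iff_inner_right]
    constructor
    · intro hx
      exact ⟨B.symm ⟨x, hx⟩, by simp⟩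
    · rintro ⟨y, rfl⟩
      simp
  · let T : ℝ ≃ₗᵢ[ℝ] (ℝ ∙ n) := LinearIsometryEquiv.toSpanUnitSingleton n hn
    have h := ((Submodule.orthogonalDecomposition (ℝ ∙ n)).symm.measurePreserving).comp
      ((WithLp.volume_preserving_toLp (ℝ ∙ n) (ℝ ∙ n)ᗮ).comp
        ((T.measurePreserving.prod B.measurePreserving).comp
          (Measure.measurePreserving_swap (μ := (volume : Measure (EuclideanSpace ℝ (Fin k))))
            (ν := (volume : Measure ℝ)))))
    convert h using 1
    · ext1 p
      simp [T, add_comm]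
    · rfl

variable {n : EuclideanSpace ℝ (Fin (k + 1))}
  {A : EuclideanSpace ℝ (Fin k) →ₗᵢ[ℝ] EuclideanSpace ℝ (Fin (k + 1))}

theorem inner_coordinates (hn : ‖n‖ = 1) (hA : ∀ x, ⟪n, x⟫_ℝ = 0 ↔ x ∈ range A)
    (y : EuclideanSpace ℝ (Fin k)) (z : ℝ) : ⟪n, A y + z • n⟫_ℝ = z := by
  rw [inner_add_right, (hA _).2 ⟨y, rfl⟩, inner_smul_right, real_inner_self_eq_norm_sq, hn]
  ring

theorem exists_coordinates (hn : ‖n‖ = 1) (hA : ∀ x, ⟪n, x⟫_ℝ = 0 ↔ x ∈ range A)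
    (x : EuclideanSpace ℝ (Fin (k + 1))) : ∃ y, A y + ⟪n, x⟫_ℝ • n = x := by
  obtain ⟨y, hy⟩ := (hA (x - ⟪n, x⟫_ℝ • n)).1 (by
    rw [inner_sub_right, inner_smul_right, real_inner_self_eq_norm_sq, hn]; ring)
  exact ⟨y, by rw [hy]; abel⟩

theorem norm_le_norm_coordinates (hn : ‖n‖ = 1) (hA : ∀ x, ⟪n, x⟫_ℝ = 0 ↔ x ∈ range A)
    (y : EuclideanSpace ℝ (Fin k)) (z : ℝ) : ‖y‖ ≤ ‖A y + z • n‖ := by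
  have h0 : ⟪n, A y⟫_ℝ = 0 := (hA _).2 ⟨y, rfl⟩
  have h : ‖A y + z • n‖ ^ 2 = ‖y‖ ^ 2 + z ^ 2 := by
    rw [norm_add_sq_real, inner_smul_right, real_inner_comm, h0, norm_smul, hn, A.norm_map]
    simp
  refine le_of_sq_le_sq ?_ (norm_nonneg _)
  rw [h]; linarith [sq_nonneg z]

theorem isometry_coordinates (c : ℝ) : Isometry fun y => A y + c • n :=
  (IsometryEquiv.addRight (c • n)).isometry.comp A.isometry

theorem range_coordinates (hn : ‖n‖ = 1) (hA : ∀ x, ⟪n, x⟫_ℝ = 0 ↔ x ∈ range A) (c : ℝ) :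
    range (fun y => A y + c • n) = {x | ⟪n, x⟫_ℝ = c} := by
  ext x
  constructor
  · rintro ⟨y, rfl⟩
    exact inner_coordinates hn hA y c
  · rintro rfl
    exact exists_coordinates hn hA x

theorem hausdorff_eq_volume_coordinates (hn : ‖n‖ = 1)
    (hA : ∀ x, ⟪n, x⟫_ℝ = 0 ↔ x ∈ range A) {c : ℝ}
    {S : Set (EuclideanSpace ℝ (Fin (k + 1)))} (hS : S ⊆ {x | ⟪n, x⟫_ℝ = c}) :
    μHE[k] S = volume ((fun y => A y + c • n) ⁻¹' S) := by
  rw [← EuclideanSpace.euclideanHausdorffMeasure_eq_volume,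
    (isometry_coordinates c).euclideanHausdorffMeasure_preimage, range_coordinates hn hA,
    inter_eq_left.2 hS]

theorem setIntegral_hausdorff_eq_coordinates (hn : ‖n‖ = 1)
    (hA : ∀ x, ⟪n, x⟫_ℝ = 0 ↔ x ∈ range A) {c : ℝ}
    {S : Set (EuclideanSpace ℝ (Fin (k + 1)))} (hS : S ⊆ {x | ⟪n, x⟫_ℝ = c})
    (φ : EuclideanSpace ℝ (Fin (k + 1)) → ℝ) :
    ∫ x in S, φ x ∂μHE[k] = ∫ y in (fun y => A y + c • n) ⁻¹' S, φ (A y + c • n) := by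
  have hi := isometry_coordinates (A := A) (n := n) c
  rw [← EuclideanSpace.euclideanHausdorffMeasure_eq_volume,
    ← hi.isClosedEmbedding.measurableEmbedding.setIntegral_map,
    hi.map_euclideanHausdorffMeasure, range_coordinates hn hA, Measure.restrict_restrict_of_subset hS]

/-- In coordinates on the first hyperplane the second condition is an affine equation. Either its
linear part is nonzero and the solutions are null, or it is constant and its failure at `p` leaves
no solution. -/
theorem hausdorff_eq_zero_of_subset_hyperplanes (hn : ‖n‖ = 1) {c : ℝ}
    {n' p : EuclideanSpace ℝ (Fin (k + 1))} {c' : ℝ} (hp : ⟪n, p⟫_ℝ = c) (hp' : ⟪n', p⟫_ℝ ≠ c')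
    {S : Set (EuclideanSpace ℝ (Fin (k + 1)))} (hS : ∀ x ∈ S, ⟪n, x⟫_ℝ = c)
    (hS' : ∀ x ∈ S, ⟪n', x⟫_ℝ = c') : μHE[k] S = 0 := by
  obtain ⟨A, hA, -⟩ := exists_hyperplane_coordinates hn
  rw [hausdorff_eq_volume_coordinates hn hA hS]
  obtain ⟨y₀, hy₀⟩ := exists_coordinates hn hA p
  rw [hp] at hy₀
  by_cases hl : (innerₛₗ ℝ n').comp A.toLinearMap = 0
  · have : (fun y => A y + c • n) ⁻¹' S = ∅ := by
      ext y
      simp only [mem_preimage, mem_empty_iff_false, iff_false]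
      intro hy
      apply hp'
      have h1 := LinearMap.congr_fun hl y
      have h2 := LinearMap.congr_fun hl y₀
      simp at h1 h2
      rw [← hS' _ hy, ← hy₀, inner_add_right, inner_add_right, h1, h2]
    rw [this, measure_empty]
  · refine measure_mono_null ?_ (volume_setOf_linearMap_eq hl (c' - c * ⟪n', n⟫_ℝ))
    intro y hy
    have := hS' _ hy
    rw [inner_add_right, inner_smul_right] at this
    simp
    linarith

/-- If the affine span filled the coordinates of the hyperplane, its direction would have dimension
`k`. This discards contacts of tiles that are not edges. -/
theorem hausdorff_eq_zero_of_finrank_ne (hn : ‖n‖ = 1) {c : ℝ}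
    {S : Set (EuclideanSpace ℝ (Fin (k + 1)))} (hS : ∀ x ∈ S, ⟪n, x⟫_ℝ = c)
    (hrank : S.Nonempty → Module.finrank ℝ (affineSpan ℝ S).direction ≠ k) : μHE[k] S = 0 := by
  obtain ⟨A, hA, -⟩ := exists_hyperplane_coordinates hn
  rcases S.eq_empty_or_nonempty with rfl | hne
  · simp
  obtain ⟨p, hp⟩ := hne
  rw [hausdorff_eq_volume_coordinates hn hA hS]
  let f : EuclideanSpace ℝ (Fin k) →ᵃ[ℝ] EuclideanSpace ℝ (Fin (k + 1)) :=
    A.toLinearMap.toAffineMap + AffineMap.const ℝ _ (c • n)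
  have hf : ∀ y, f y = A y + c • n := fun y => rfl
  refine measure_mono_null (t := ((affineSpan ℝ S).comap f : Set _)) ?_
    (Measure.addHaar_affineSubspace _ _ fun htop => hrank ⟨p, hp⟩ ?_)
  · intro y hy
    exact subset_affineSpan ℝ S hy
  · have hall : ∀ y, f y ∈ affineSpan ℝ S := fun y => by
      have : y ∈ (affineSpan ℝ S).comap f := by rw [htop]; trivial
      exact this
    have hdir : (affineSpan ℝ S).direction = LinearMap.range A.toLinearMap := by
      apply le_antisymm
      · rw [direction_affineSpan, vectorSpan_def, Submodule.span_le]
        rintro _ ⟨x, hx, y, hy, rfl⟩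
        have : ⟪n, x - y⟫_ℝ = 0 := by rw [inner_sub_right, hS x hx, hS y hy, sub_self]
        exact (hA _).1 this
      · rintro _ ⟨y, rfl⟩
        have := AffineSubspace.vsub_mem_direction (hall y) (hall 0)
        simpa [hf] using this
    rw [hdir, LinearMap.finrank_range_of_inj A.injective, finrank_euclideanSpace_fin]

end Hyperplane

/-! ### Cones over a facet and their volume -/

theorem IsCompact.convexJoin' {E : Type*} [NormedAddCommGroup E] [NormedSpace ℝ E] {S T : Set E}
    (hS : IsCompact S) (hT : IsCompact T) : IsCompact (convexJoin ℝ S T) := by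
  have h : convexJoin ℝ S T =
      (fun q : ℝ × E × E => q.2.1 + q.1 • (q.2.2 - q.2.1)) '' (Icc (0 : ℝ) 1 ×ˢ S ×ˢ T) := by
    ext x
    simp only [mem_convexJoin, segment_eq_image', mem_image, mem_prod, Prod.exists]
    constructor
    · rintro ⟨a, ha, b, hb, t, ht, rfl⟩
      exact ⟨t, a, b, ⟨ht, ha, hb⟩, rfl⟩
    · rintro ⟨t, a, b, ⟨ht, ha, hb⟩, rfl⟩
      exact ⟨a, ha, b, hb, t, ht, rfl⟩
  rw [h]
  exact (isCompact_Icc.prod (hS.prod hT)).image (by fun_prop)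

theorem isCompact_convexHull_insert {E : Type*} [NormedAddCommGroup E] [NormedSpace ℝ E]
    {S : Set E} (hS : IsCompact S) (hSc : Convex ℝ S) (p : E) :
    IsCompact (convexHull ℝ (insert p S)) := by
  rcases S.eq_empty_or_nonempty with rfl | hne
  · simp
  · rw [convexHull_insert hne, hSc.convexHull_eq]
    exact isCompact_singleton.convexJoin' hS

section Cone

variable {k : ℕ} {n : EuclideanSpace ℝ (Fin (k + 1))}

theorem mem_convexHull_insert_iff {p : EuclideanSpace ℝ (Fin (k + 1))}
    {S : Set (EuclideanSpace ℝ (Fin (k + 1)))} {c : ℝ} (hpc : ⟪n, p⟫_ℝ < c) (hSc : Convex ℝ S)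
    (hS : ∀ x ∈ S, ⟪n, x⟫_ℝ = c) (hne : S.Nonempty) {x : EuclideanSpace ℝ (Fin (k + 1))} :
    x ∈ convexHull ℝ (insert p S) ↔
      ∃ y ∈ S, x = p + ((⟪n, x⟫_ℝ - ⟪n, p⟫_ℝ) / (c - ⟪n, p⟫_ℝ)) • (y - p) ∧
        ⟪n, p⟫_ℝ ≤ ⟪n, x⟫_ℝ ∧ ⟪n, x⟫_ℝ ≤ c := by
  have hpos : 0 < c - ⟪n, p⟫_ℝ := by linarith
  rw [convexHull_insert hne, hSc.convexHull_eq, mem_convexJoin]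
  simp only [mem_singleton_iff, exists_eq_left]
  constructor
  · rintro ⟨y, hy, hx⟩
    rw [segment_eq_image'] at hx
    obtain ⟨t, ⟨ht0, ht1⟩, rfl⟩ := hx
    have h : ⟪n, p + t • (y - p)⟫_ℝ = ⟪n, p⟫_ℝ + t * (c - ⟪n, p⟫_ℝ) := by
      rw [inner_add_right, inner_smul_right, inner_sub_right, hS y hy]
    refine ⟨y, hy, ?_, ?_, ?_⟩
    · simp only [h]
      rw [add_sub_cancel_left, mul_div_cancel_right₀ _ hpos.ne']
    · simp only [h]; nlinarith
    · simp only [h]; nlinarith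
  · rintro ⟨y, hy, hx, h0, h1⟩
    refine ⟨y, hy, ?_⟩
    rw [segment_eq_image']
    exact ⟨_, ⟨div_nonneg (by linarith) hpos.le, (div_le_one hpos).2 (by linarith)⟩, hx.symm⟩

/-- The slice at height `z` is a homothetic copy of the base, with ratio proportional to the
distance from the apex. Integrating the `k`-th power of the ratio gives height over `k + 1`. -/
theorem volume_convexHull_insert (hn : ‖n‖ = 1) {p : EuclideanSpace ℝ (Fin (k + 1))}
    {S : Set (EuclideanSpace ℝ (Fin (k + 1)))} {c : ℝ} (hpc : ⟪n, p⟫_ℝ < c) (hSc : Convex ℝ S)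
    (hcomp : IsCompact S) (hS : ∀ x ∈ S, ⟪n, x⟫_ℝ = c) (hne : S.Nonempty) :
    volume (convexHull ℝ (insert p S)) =
      ENNReal.ofReal ((c - ⟪n, p⟫_ℝ) / (k + 1)) * μHE[k] S := by
  obtain ⟨A, hA, hmp⟩ := exists_hyperplane_coordinates hn
  have hpos : 0 < c - ⟪n, p⟫_ℝ := by linarith
  have hmeas : MeasurableSet (convexHull ℝ (insert p S)) :=
    (isCompact_convexHull_insert hcomp hSc p).isClosed.measurableSet
  rw [← hmp.measure_preimage hmeas.nullMeasurableSet, hausdorff_eq_volume_coordinates hn hA hS]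
  change (volume.prod volume) _ = _
  rw [Measure.prod_apply_symm (hmp.measurable hmeas)]
  set S' := (fun y => A y + c • n) ⁻¹' S with hS'
  obtain ⟨p', hp'⟩ := exists_coordinates hn hA p
  have hslice : ∀ z ∈ Ioo ⟪n, p⟫_ℝ c,
      volume ((fun y => (y, z)) ⁻¹' ((fun q : EuclideanSpace ℝ (Fin k) × ℝ => A q.1 + q.2 • n) ⁻¹'
        convexHull ℝ (insert p S))) =
      ENNReal.ofReal (((z - ⟪n, p⟫_ℝ) / (c - ⟪n, p⟫_ℝ)) ^ k) * volume S' := by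
    intro z hz
    have ht : 0 < (z - ⟪n, p⟫_ℝ) / (c - ⟪n, p⟫_ℝ) := div_pos (by linarith [hz.1]) hpos
    have htc : (z - ⟪n, p⟫_ℝ) / (c - ⟪n, p⟫_ℝ) * (c - ⟪n, p⟫_ℝ) = z - ⟪n, p⟫_ℝ := by
      field_simp
    have hhom : ∀ y', A (AffineMap.homothety p' ((z - ⟪n, p⟫_ℝ) / (c - ⟪n, p⟫_ℝ)) y') + z • n =
        p + ((z - ⟪n, p⟫_ℝ) / (c - ⟪n, p⟫_ℝ)) • (A y' + c • n - p) := by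
      intro y'
      have hz' : z = ⟪n, p⟫_ℝ + (z - ⟪n, p⟫_ℝ) / (c - ⟪n, p⟫_ℝ) * (c - ⟪n, p⟫_ℝ) := by
        rw [htc]; ring
      have e : z • n = ⟪n, p⟫_ℝ • n +
          ((z - ⟪n, p⟫_ℝ) / (c - ⟪n, p⟫_ℝ)) • ((c - ⟪n, p⟫_ℝ) • n) := by
        rw [smul_smul, ← add_smul, ← hz']
      rw [e]
      generalize (z - ⟪n, p⟫_ℝ) / (c - ⟪n, p⟫_ℝ) = t
      generalize ⟪n, p⟫_ℝ = b at hp'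
      rw [← hp']
      simp only [AffineMap.homothety_apply, vsub_eq_sub, vadd_eq_add, map_add, map_smul, map_sub]
      module
    have himage : (fun y => (y, z)) ⁻¹'
        ((fun q : EuclideanSpace ℝ (Fin k) × ℝ => A q.1 + q.2 • n) ⁻¹' convexHull ℝ (insert p S)) =
        AffineMap.homothety p' ((z - ⟪n, p⟫_ℝ) / (c - ⟪n, p⟫_ℝ)) '' S' := by
      ext y
      simp only [mem_preimage, mem_image]
      rw [mem_convexHull_insert_iff hpc hSc hS hne, inner_coordinates hn hA]
      constructor
      · rintro ⟨s, hs, hx, -, -⟩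
        obtain ⟨y', hy'⟩ := exists_coordinates hn hA s
        rw [hS s hs] at hy'
        refine ⟨y', by rw [hS', mem_preimage, hy']; exact hs, ?_⟩
        have := hhom y'
        rw [hy', ← hx] at this
        exact A.injective (add_right_cancel this)
      · rintro ⟨y', hy', rfl⟩
        exact ⟨_, hy', hhom y', hz.1.le, hz.2.le⟩
    rw [himage, Measure.addHaar_image_homothety, finrank_euclideanSpace_fin,
      abs_of_nonneg (pow_nonneg ht.le k)]
  have hout : ∀ z ∉ Icc ⟪n, p⟫_ℝ c,
      volume ((fun y => (y, z)) ⁻¹' ((fun q : EuclideanSpace ℝ (Fin k) × ℝ => A q.1 + q.2 • n) ⁻¹'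
        convexHull ℝ (insert p S))) = 0 := by
    intro z hz
    rw [← measure_empty (μ := (volume : Measure (EuclideanSpace ℝ (Fin k))))]
    congr 1
    ext y
    simp only [mem_preimage, mem_empty_iff_false, iff_false]
    rw [mem_convexHull_insert_iff hpc hSc hS hne, inner_coordinates hn hA]
    rintro ⟨s, hs, -, h0, h1⟩
    exact hz ⟨h0, h1⟩
  rw [← setLIntegral_eq_of_support_subset (s := Icc ⟪n, p⟫_ℝ c)]
  · rw [setLIntegral_congr Ioo_ae_eq_Icc.symm, setLIntegral_congr_fun measurableSet_Ioo hslice,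
      lintegral_mul_const']
    · congr 1
      rw [← ofReal_integral_eq_lintegral_ofReal, ← integral_Ioc_eq_integral_Ioo,
        ← intervalIntegral.integral_of_le hpc.le]
      · congr 1
        simp only [div_pow]
        rw [intervalIntegral.integral_div,
          intervalIntegral.integral_comp_sub_right (fun z => z ^ k), integral_pow]
        simp
        field_simp
        ring
      · exact (Continuous.integrableOn_Icc (by fun_prop)).mono_set Ioo_subset_Icc_self
      · filter_upwards [ae_restrict_mem measurableSet_Ioo] with z hz
        exact pow_nonneg (div_nonneg (by linarith [hz.1]) hpos.le) _
    · rw [hS', ← hausdorff_eq_volume_coordinates hn hA hS]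
      rw [hausdorff_eq_volume_coordinates hn hA hS]
      exact ((isometry_coordinates c).isClosedEmbedding.isCompact_preimage hcomp).measure_ne_top
  · intro z hz
    by_contra h
    exact hz (hout z h)

end Cone

/-! ### Smooth cutoffs of a half-space -/

section SmoothTransition

open Filter Topology Real

theorem deriv_smoothTransition_eq_zero {t : ℝ} (ht : t ∉ Icc (0 : ℝ) 1) :
    deriv smoothTransition t = 0 := by
  rcases not_and_or.1 ht with h | h
  · have : smoothTransition =ᶠ[𝓝 t] fun _ => 0 := by
      filter_upwards [Iio_mem_nhds (not_le.1 h)] with x hx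
      exact smoothTransition.zero_of_nonpos (le_of_lt hx)
    rw [this.deriv_eq, deriv_const]
  · have : smoothTransition =ᶠ[𝓝 t] fun _ => 1 := by
      filter_upwards [Ioi_mem_nhds (not_le.1 h)] with x hx
      exact smoothTransition.one_of_one_le (le_of_lt hx)
    rw [this.deriv_eq, deriv_const]

theorem continuous_deriv_smoothTransition : Continuous (deriv smoothTransition) :=
  (smoothTransition.contDiff (n := 1)).continuous_deriv le_rfl

theorem hasCompactSupport_deriv_smoothTransition :
    HasCompactSupport (deriv smoothTransition) :=
  HasCompactSupport.intro isCompact_Icc fun _ => deriv_smoothTransition_eq_zero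

theorem integrable_deriv_smoothTransition : Integrable (deriv smoothTransition) :=
  continuous_deriv_smoothTransition.integrable_of_hasCompactSupport
    hasCompactSupport_deriv_smoothTransition

theorem integral_deriv_smoothTransition : ∫ t, deriv smoothTransition t = 1 := by
  have h1 : ∫ t in Icc (0 : ℝ) 1, deriv smoothTransition t = ∫ t, deriv smoothTransition t :=
    setIntegral_eq_integral_of_forall_compl_eq_zero fun t ht => deriv_smoothTransition_eq_zero ht
  rw [← h1, integral_Icc_eq_integral_Ioc, ← intervalIntegral.integral_of_le zero_le_one,
    intervalIntegral.integral_deriv_eq_sub]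
  · simp
  · exact fun x _ => (smoothTransition.contDiffAt (n := 1)).differentiableAt one_ne_zero
  · exact continuous_deriv_smoothTransition.intervalIntegrable _ _

theorem tendsto_smoothTransition_div {a : ℝ} (b : ℝ) (h : a ≠ 0 ∨ b = 0) :
    Tendsto (fun s => smoothTransition ((a + s * b) / s)) (𝓝[>] 0)
      (𝓝 (if 0 < a then 1 else 0)) := by
  have hlim : ∀ b' : ℝ, Tendsto (fun s : ℝ => a + s * b') (𝓝[>] 0) (𝓝 a) := fun b' => by
    have : Tendsto (fun s : ℝ => a + s * b') (𝓝 0) (𝓝 (a + 0 * b')) := by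
      apply Continuous.tendsto; fun_prop
    rw [zero_mul, add_zero] at this
    exact this.mono_left nhdsWithin_le_nhds
  rcases lt_trichotomy a 0 with ha | rfl | ha
  · rw [if_neg ha.le.not_gt]
    refine tendsto_const_nhds.congr' ?_
    filter_upwards [(hlim b).eventually (Iio_mem_nhds ha), self_mem_nhdsWithin] with s hs hs0
    exact (smoothTransition.zero_of_nonpos (div_nonpos_of_nonpos_of_nonneg (le_of_lt hs)
      (le_of_lt hs0))).symm
  · obtain rfl : b = 0 := by simpa using h
    simp
  · rw [if_pos ha]
    refine tendsto_const_nhds.congr' ?_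
    filter_upwards [(hlim (b - 1)).eventually (Ioi_mem_nhds ha), self_mem_nhdsWithin] with s hs hs0
    refine (smoothTransition.one_of_one_le ?_).symm
    rw [le_div_iff₀ hs0]
    have : 0 < a + s * (b - 1) := hs
    linarith

end SmoothTransition

/-! ### The divergence theorem on a polytope -/

section Divergence

open Filter Topology Real

variable {k : ℕ} {n : EuclideanSpace ℝ (Fin (k + 1))}
  {A : EuclideanSpace ℝ (Fin k) →ₗᵢ[ℝ] EuclideanSpace ℝ (Fin (k + 1))}

theorem measurePreserving_collar
    (hmp : MeasurePreserving (fun p : EuclideanSpace ℝ (Fin k) × ℝ => A p.1 + p.2 • n))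
    (c : ℝ) {s : ℝ} (hs : 0 < s) :
    MeasurePreserving (fun p : EuclideanSpace ℝ (Fin k) × ℝ => A p.1 + (c - s * p.2) • n)
      (ENNReal.ofReal s • volume) volume := by
  have h1 : MeasurePreserving (fun t : ℝ => s * t) (ENNReal.ofReal s • volume) volume := by
    refine ⟨by fun_prop, ?_⟩
    rw [Measure.map_smul, Real.map_volume_mul_left hs.ne', smul_smul, abs_of_pos (inv_pos.2 hs),
      ← ENNReal.ofReal_mul hs.le, mul_inv_cancel₀ hs.ne', ENNReal.ofReal_one, one_smul]
  have h2 := (Measure.measurePreserving_sub_left (volume : Measure ℝ) c).comp h1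
  have h3 := hmp.comp ((MeasurePreserving.id (volume : Measure (EuclideanSpace ℝ (Fin k)))).prod h2)
  rw [Measure.prod_smul_right] at h3
  exact h3

/-- The derivative of a cutoff concentrates on the hyperplane. Measuring the normal distance in
units of `s` cancels the factor `s⁻¹` and fixes the profile, whose integral is one; dominated
convergence does the rest. In the application `ρ` is the product of the other cutoffs. -/
theorem tendsto_integral_collar (hn : ‖n‖ = 1) (c : ℝ)
    {φ : EuclideanSpace ℝ (Fin (k + 1)) → ℝ} (hφ : Continuous φ) (hφc : HasCompactSupport φ)
    {ρ : ℝ → EuclideanSpace ℝ (Fin (k + 1)) → ℝ} (hρ : ∀ s, Continuous (ρ s))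
    (hρ1 : ∀ s x, |ρ s x| ≤ 1) {S N : Set (EuclideanSpace ℝ (Fin (k + 1)))}
    (hS : S ⊆ {x | ⟪n, x⟫_ℝ = c}) (hSm : MeasurableSet S) (hN : N ⊆ {x | ⟪n, x⟫_ℝ = c})
    (hN0 : μHE[k] N = 0)
    (hlim : ∀ p, ⟪n, p⟫_ℝ = c → p ∉ N → ∀ τ, Tendsto (fun s => ρ s (p - (s * τ) • n)) (𝓝[>] 0)
      (𝓝 (S.indicator 1 p))) :
    Tendsto (fun s => ∫ x, φ x * (s⁻¹ * deriv smoothTransition ((c - ⟪n, x⟫_ℝ) / s)) * ρ s x)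
      (𝓝[>] 0) (𝓝 (∫ x in S, φ x ∂μHE[k])) := by
  obtain ⟨A, hA, hmp⟩ := exists_hyperplane_coordinates hn
  set f : EuclideanSpace ℝ (Fin k) → EuclideanSpace ℝ (Fin (k + 1)) := fun y => A y + c • n with hf
  have hfc : Continuous f := by have := A.continuous; fun_prop
  have hΦ : ∀ s, Continuous
      fun p : EuclideanSpace ℝ (Fin k) × ℝ => A p.1 + (c - s * p.2) • n := fun s => by
    have := A.continuous; fun_prop
  have hη := continuous_deriv_smoothTransition
  have hlimit : ∫ x in S, φ x ∂μHE[k] = ∫ p : EuclideanSpace ℝ (Fin k) × ℝ,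
      (f ⁻¹' S).indicator (fun y => φ (f y)) p.1 * deriv smoothTransition p.2 := by
    change _ = ∫ p, _ ∂(volume.prod volume)
    rw [integral_prod_mul, integral_deriv_smoothTransition, mul_one,
      integral_indicator (hfc.measurable hSm), setIntegral_hausdorff_eq_coordinates hn hA hS]
  have hcongr : ∀ s : ℝ, 0 < s →
      ∫ p : EuclideanSpace ℝ (Fin k) × ℝ, φ (A p.1 + (c - s * p.2) • n) *
        deriv smoothTransition p.2 * ρ s (A p.1 + (c - s * p.2) • n) =
      ∫ x, φ x * (s⁻¹ * deriv smoothTransition ((c - ⟪n, x⟫_ℝ) / s)) * ρ s x := by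
    intro s hs
    have hinj : Function.Injective
        fun p : EuclideanSpace ℝ (Fin k) × ℝ => A p.1 + (c - s * p.2) • n := by
      intro p q hpq
      have h1 := congrArg (fun x => ⟪n, x⟫_ℝ) hpq
      simp only [inner_coordinates hn hA] at h1
      have h2 : p.2 = q.2 := by
        have : s * p.2 = s * q.2 := by linarith
        exact mul_left_cancel₀ hs.ne' this
      simp only [h2] at hpq
      exact Prod.ext (A.injective (add_right_cancel hpq)) h2
    rw [← (measurePreserving_collar hmp c hs).integral_comp
      ((hΦ s).measurableEmbedding hinj), integral_smul_measure, ENNReal.toReal_ofReal hs.le,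
      smul_eq_mul, ← integral_const_mul]
    congr 1
    ext p
    rw [inner_coordinates hn hA]
    have e : (c - (c - s * p.2)) / s = p.2 := by field_simp; ring
    rw [e]
    field_simp
  rw [hlimit]
  refine Tendsto.congr' (f₁ := fun s => ∫ p : EuclideanSpace ℝ (Fin k) × ℝ,
    φ (A p.1 + (c - s * p.2) • n) * deriv smoothTransition p.2 *
      ρ s (A p.1 + (c - s * p.2) • n))
    (by filter_upwards [self_mem_nhdsWithin] with s hs using hcongr s hs) ?_
  obtain ⟨B, hB⟩ := hφ.bounded_above_of_compact_support hφc
  obtain ⟨R, hR⟩ := hφc.isBounded.exists_norm_le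
  refine tendsto_integral_filter_of_dominated_convergence
    (fun p => (Metric.closedBall (0 : EuclideanSpace ℝ (Fin k)) R).indicator (fun _ => B) p.1 *
      |deriv smoothTransition p.2|) ?_ ?_ ?_ ?_
  · filter_upwards with s
    have := (hρ s).comp (hΦ s)
    have h2 := hφ.comp (hΦ s)
    apply Continuous.aestronglyMeasurable
    exact (h2.mul (hη.comp continuous_snd)).mul this
  · filter_upwards with s
    filter_upwards with p
    rw [norm_mul, norm_mul, Real.norm_eq_abs (ρ _ _), Real.norm_eq_abs (deriv _ _)]
    refine (mul_le_of_le_one_right (by positivity) (hρ1 _ _)).trans ?_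
    gcongr
    by_cases hp : A p.1 + (c - s * p.2) • n ∈ tsupport φ
    · rw [indicator_of_mem]
      · exact hB _
      · rw [mem_closedBall_zero_iff]
        exact (norm_le_norm_coordinates hn hA _ _).trans (hR _ hp)
    · rw [image_eq_zero_of_notMem_tsupport hp, norm_zero]
      exact indicator_nonneg (fun _ _ => (norm_nonneg _).trans (hB 0)) _
  · change Integrable _ (volume.prod volume)
    refine Integrable.mul_prod (f := (Metric.closedBall (0 : EuclideanSpace ℝ (Fin k)) R).indicator
      fun _ => B) (g := fun t => |deriv smoothTransition t|) ?_ ?_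
    · rw [integrable_indicator_iff measurableSet_closedBall]
      exact integrableOn_const measure_closedBall_lt_top.ne
    · exact integrable_deriv_smoothTransition.abs
  · have hN' : ∀ᵐ y : EuclideanSpace ℝ (Fin k), f y ∉ N := by
      rw [ae_iff]
      rw [hausdorff_eq_volume_coordinates hn hA hN] at hN0
      simpa [hf, preimage] using hN0
    have hN'' : ∀ᵐ p : EuclideanSpace ℝ (Fin k) × ℝ, f p.1 ∉ N :=
      Measure.quasiMeasurePreserving_fst.ae hN'
    filter_upwards [hN''] with p hp
    have e : ∀ s, A p.1 + (c - s * p.2) • n = f p.1 - (s * p.2) • n := fun s => by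
      simp only [hf]; module
    have h1 := hlim (f p.1) (inner_coordinates hn hA _ _) hp p.2
    have h2 : Tendsto (fun s : ℝ => φ (f p.1 - (s * p.2) • n)) (𝓝[>] 0) (𝓝 (φ (f p.1))) := by
      have : Tendsto (fun s : ℝ => φ (f p.1 - (s * p.2) • n)) (𝓝 0)
          (𝓝 (φ (f p.1 - ((0 : ℝ) * p.2) • n))) := by
        apply Continuous.tendsto; fun_prop
      simp only [zero_mul, zero_smul, sub_zero] at this
      exact this.mono_left nhdsWithin_le_nhds
    simp only [e]
    convert (h2.mul_const _).mul h1 using 2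
    by_cases hs : f p.1 ∈ S
    · rw [indicator_of_mem (by exact hs), indicator_of_mem hs]; simp
    · rw [indicator_of_notMem (by exact hs), indicator_of_notMem hs]; simp

/-- If the first hyperplane lay in the second, the two pairs would agree up to a common sign. Equal
signs are excluded by assumption, opposite signs by the point `v` strictly below both. -/
theorem exists_mem_hyperplane_inner_ne {n n' v : EuclideanSpace ℝ (Fin (k + 1))} {c c' : ℝ}
    (hn : ‖n‖ = 1) (hn' : ‖n'‖ = 1) (hv : ⟪n, v⟫_ℝ < c) (hv' : ⟪n', v⟫_ℝ < c')
    (hne : (n, c) ≠ (n', c')) : ∃ p, ⟪n, p⟫_ℝ = c ∧ ⟪n', p⟫_ℝ ≠ c' := by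
  by_contra! h
  have hnn : ⟪n, n⟫_ℝ = 1 := by rw [real_inner_self_eq_norm_sq, hn]; norm_num
  have hnn' : ⟪n', n'⟫_ℝ = 1 := by rw [real_inner_self_eq_norm_sq, hn']; norm_num
  have h0 : ∀ x, ⟪n, x⟫_ℝ = 0 → ⟪n', x⟫_ℝ = 0 := by
    intro x hx
    have h1 := h (c • n + x) (by rw [inner_add_right, inner_smul_right, hnn, hx]; ring)
    have h2 := h (c • n) (by rw [inner_smul_right, hnn]; ring)
    rw [inner_add_right, h2] at h1
    linarith
  set t := ⟪n, n'⟫_ℝ with ht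
  have hx : ⟪n, n' - t • n⟫_ℝ = 0 := by
    rw [inner_sub_right, inner_smul_right, hnn, ht]; ring
  have hx' := h0 _ hx
  have hz : n' - t • n = 0 := by
    rw [← inner_self_eq_zero (𝕜 := ℝ), inner_sub_left, inner_smul_left, hx, hx']; simp
  have hn't : n' = t • n := sub_eq_zero.1 hz
  have hc' : c' = t * c := by
    rw [← h (c • n) (by rw [inner_smul_right, hnn]; ring), hn't, inner_smul_left, inner_smul_right,
      hnn]; simp
  have ht2 : t * t = 1 := by
    have := hnn'
    rw [hn't, inner_smul_left, inner_smul_right, hnn] at this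
    simpa using this
  rcases mul_self_eq_one_iff.1 ht2 with h1 | h1
  · rw [h1, one_smul] at hn't
    rw [h1, one_mul] at hc'
    exact hne (by rw [hn't, hc'])
  · rw [hn't, hc', h1, inner_smul_left] at hv'
    simp at hv'
    linarith

/-- Integrate by parts against a product of smoothed half-space cutoffs and let their width tend to
zero. The derivative of the `i`-th factor concentrates on the `i`-th face; overlaps of faces are
null because the interior point `v` keeps distinct hyperplanes from coinciding. -/
theorem integral_polytope_fderiv {I : Finset (EuclideanSpace ℝ (Fin (k + 1)) × ℝ)}
    (hI : ∀ i ∈ I, ‖i.1‖ = 1) {v : EuclideanSpace ℝ (Fin (k + 1))}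
    (hv : ∀ i ∈ I, ⟪i.1, v⟫_ℝ < i.2)
    {φ : EuclideanSpace ℝ (Fin (k + 1)) → ℝ} (hφ : ContDiff ℝ 1 φ) (hφc : HasCompactSupport φ)
    (u : EuclideanSpace ℝ (Fin (k + 1))) :
    ∫ x in {x | ∀ i ∈ I, ⟪i.1, x⟫_ℝ ≤ i.2}, fderiv ℝ φ x u =
      ∑ i ∈ I, ⟪i.1, u⟫_ℝ *
        ∫ x in {x | ∀ i ∈ I, ⟪i.1, x⟫_ℝ ≤ i.2} ∩ {x | ⟪i.1, x⟫_ℝ = i.2}, φ x ∂μHE[k] := by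
  classical
  set P : Set (EuclideanSpace ℝ (Fin (k + 1))) := {x | ∀ i ∈ I, ⟪i.1, x⟫_ℝ ≤ i.2} with hP
  have hPm : MeasurableSet P := by
    have : P = ⋂ i ∈ I, {x | ⟪i.1, x⟫_ℝ ≤ i.2} := by ext; simp [hP]
    rw [this]
    exact Finset.measurableSet_biInter _ fun i _ =>
      (isClosed_le (by fun_prop) continuous_const).measurableSet
  let η : EuclideanSpace ℝ (Fin (k + 1)) × ℝ → ℝ → EuclideanSpace ℝ (Fin (k + 1)) → ℝ :=
    fun i s x => smoothTransition ((i.2 - ⟪i.1, x⟫_ℝ) / s)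
  have hη0 : ∀ i s x, 0 ≤ η i s x := fun i s x => smoothTransition.nonneg _
  have hη1 : ∀ i s x, η i s x ≤ 1 := fun i s x => smoothTransition.le_one _
  have hηc : ∀ i s, Continuous (η i s) := fun i s =>
    smoothTransition.continuous.comp (by fun_prop)
  have hprod1 : ∀ (J : Finset (EuclideanSpace ℝ (Fin (k + 1)) × ℝ)) s x,
      |∏ i ∈ J, η i s x| ≤ 1 := fun J s x => by
    rw [abs_of_nonneg (Finset.prod_nonneg fun i _ => hη0 i s x)]
    exact Finset.prod_le_one (fun i _ => hη0 i s x) (fun i _ => hη1 i s x)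
  have hprodc : ∀ (J : Finset (EuclideanSpace ℝ (Fin (k + 1)) × ℝ)) s,
      Continuous fun x => ∏ i ∈ J, η i s x := fun J s =>
    continuous_finsetProd _ fun i _ => hηc i s
  -- derivative of the cutoff
  have hηd : ∀ i s x, HasFDerivAt (η i s)
      ((deriv smoothTransition ((i.2 - ⟪i.1, x⟫_ℝ) / s)) • ((-s⁻¹) • innerSL ℝ i.1)) x := by
    intro i s x
    have h1 : HasDerivAt smoothTransition (deriv smoothTransition ((i.2 - ⟪i.1, x⟫_ℝ) / s))
        ((i.2 - ⟪i.1, x⟫_ℝ) / s) :=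
      ((smoothTransition.contDiffAt (n := 1)).differentiableAt one_ne_zero).hasDerivAt
    have h2 : HasFDerivAt (fun x => (i.2 - ⟪i.1, x⟫_ℝ) / s) ((-s⁻¹) • innerSL ℝ i.1) x := by
      have := (((innerSL ℝ i.1).hasFDerivAt (x := x)).const_sub i.2).mul_const s⁻¹
      simp only [smul_neg, ← neg_smul] at this
      simpa [div_eq_mul_inv] using this
    exact h1.comp_hasFDerivAt x h2
  have hχd : ∀ s x, HasFDerivAt (fun x => ∏ i ∈ I, η i s x)
      (∑ i ∈ I, (∏ j ∈ I.erase i, η j s x) •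
        ((deriv smoothTransition ((i.2 - ⟪i.1, x⟫_ℝ) / s)) • ((-s⁻¹) • innerSL ℝ i.1))) x :=
    fun s x => HasFDerivAt.finsetProd fun i _ => hηd i s x
  have hφd : Continuous fun x => fderiv ℝ φ x u :=
    (hφ.continuous_fderiv one_ne_zero).clm_apply continuous_const
  have hφdc : HasCompactSupport fun x => fderiv ℝ φ x u := hφc.fderiv_apply (𝕜 := ℝ) u
  have hcont : ∀ i s, Continuous fun x => φ x * (s⁻¹ *
      deriv smoothTransition ((i.2 - ⟪i.1, x⟫_ℝ) / s)) * ∏ j ∈ I.erase i, η j s x := by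
    intro i s
    have h1 : Continuous fun x => deriv smoothTransition ((i.2 - ⟪i.1, x⟫_ℝ) / s) :=
      continuous_deriv_smoothTransition.comp (by fun_prop)
    exact (hφ.continuous.mul (continuous_const.mul h1)).mul (hprodc _ s)
  have hint : ∀ i s, Integrable fun x => φ x * (s⁻¹ *
      deriv smoothTransition ((i.2 - ⟪i.1, x⟫_ℝ) / s)) * ∏ j ∈ I.erase i, η j s x := fun i s =>
    (hcont i s).integrable_of_hasCompactSupport hφc.mul_right.mul_right
  have hexp : ∀ s x, φ x * fderiv ℝ (fun x => ∏ i ∈ I, η i s x) x u =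
      -∑ i ∈ I, ⟪i.1, u⟫_ℝ * (φ x * (s⁻¹ *
        deriv smoothTransition ((i.2 - ⟪i.1, x⟫_ℝ) / s)) * ∏ j ∈ I.erase i, η j s x) := by
    intro s x
    rw [(hχd s x).fderiv, sum_apply, Finset.mul_sum, ← Finset.sum_neg_distrib]
    refine Finset.sum_congr rfl fun i _ => ?_
    simp
    ring
  have hparts : ∀ s, ∫ x, fderiv ℝ φ x u * ∏ i ∈ I, η i s x =
      ∑ i ∈ I, ⟪i.1, u⟫_ℝ * ∫ x, φ x * (s⁻¹ *
        deriv smoothTransition ((i.2 - ⟪i.1, x⟫_ℝ) / s)) * ∏ j ∈ I.erase i, η j s x := by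
    intro s
    have h := integral_mul_fderiv_eq_neg_fderiv_mul_of_integrable (μ := volume) (f := φ)
      (g := fun x => ∏ i ∈ I, η i s x) (v := u)
      ((hφd.mul (hprodc I s)).integrable_of_hasCompactSupport hφdc.mul_right)
      (by
        simp only [hexp]
        exact (integrable_finsetSum _ fun i _ => (hint i s).const_mul _).neg)
      ((hφ.continuous.mul (hprodc I s)).integrable_of_hasCompactSupport hφc.mul_right)
      (fun x _ => hφ.differentiable one_ne_zero x)
      (fun x _ => (hχd s x).differentiableAt)
    simp only [hexp] at h
    rw [integral_neg, neg_inj, integral_finsetSum _ fun i _ => (hint i s).const_mul _] at h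
    rw [← h]
    exact Finset.sum_congr rfl fun i _ => integral_const_mul _ _
  -- The argument moves with `s` to follow the rescaled collar; `w = 0` serves the volume integral.
  have hlimprod : ∀ (J : Finset (EuclideanSpace ℝ (Fin (k + 1)) × ℝ)) (x w : _),
      (∀ i ∈ J, i.2 - ⟪i.1, x⟫_ℝ ≠ 0 ∨ ⟪i.1, w⟫_ℝ = 0) →
      Tendsto (fun s => ∏ i ∈ J, η i s (x - s • w)) (𝓝[>] 0)
        (𝓝 (∏ i ∈ J, if 0 < i.2 - ⟪i.1, x⟫_ℝ then 1 else 0)) := by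
    intro J x w h
    refine tendsto_finsetProd _ fun i hi => ?_
    refine (tendsto_smoothTransition_div ⟪i.1, w⟫_ℝ (h i hi)).congr fun s => ?_
    simp only [η, inner_sub_right, inner_smul_right]
    congr 2; ring
  -- the left side
  have hL : Tendsto (fun s => ∫ x, fderiv ℝ φ x u * ∏ i ∈ I, η i s x) (𝓝[>] 0)
      (𝓝 (∫ x in P, fderiv ℝ φ x u)) := by
    have hnull : ∀ᵐ x : EuclideanSpace ℝ (Fin (k + 1)), ∀ i ∈ I, ⟪i.1, x⟫_ℝ ≠ i.2 := by
      rw [Finset.eventually_all]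
      intro i hi
      rw [ae_iff]
      simp only [not_not]
      refine volume_setOf_linearMap_eq (l := innerₛₗ ℝ i.1) (fun h => ?_) i.2
      have := LinearMap.congr_fun h i.1
      simp at this
      have h1 := hI i hi
      simp [this] at h1
    rw [← integral_indicator hPm]
    refine tendsto_integral_filter_of_dominated_convergence (fun x => |fderiv ℝ φ x u|) ?_ ?_ ?_ ?_
    · filter_upwards with s
      exact (hφd.mul (hprodc I s)).aestronglyMeasurable
    · filter_upwards with s
      filter_upwards with x
      rw [norm_mul, Real.norm_eq_abs, Real.norm_eq_abs]
      exact mul_le_of_le_one_right (abs_nonneg _) (hprod1 I s x)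
    · exact (hφd.integrable_of_hasCompactSupport hφdc).abs
    · filter_upwards [hnull] with x hx
      have h := hlimprod I x 0 (by simp)
      simp only [smul_zero, sub_zero] at h
      convert h.const_mul (fderiv ℝ φ x u) using 2
      by_cases hxP : x ∈ P
      · rw [indicator_of_mem hxP, Finset.prod_eq_one, mul_one]
        intro i hi
        rw [if_pos]
        exact sub_pos.2 (lt_of_le_of_ne (hxP i hi) (hx i hi))
      · rw [indicator_of_notMem hxP]
        have : ∃ i ∈ I, i.2 < ⟪i.1, x⟫_ℝ := by simpa [hP] using hxP
        obtain ⟨i, hi, hxi⟩ := this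
        rw [Finset.prod_eq_zero hi, mul_zero]
        rw [if_neg]
        linarith
  have hR : Tendsto (fun s => ∑ i ∈ I, ⟪i.1, u⟫_ℝ * ∫ x, φ x * (s⁻¹ *
        deriv smoothTransition ((i.2 - ⟪i.1, x⟫_ℝ) / s)) * ∏ j ∈ I.erase i, η j s x) (𝓝[>] 0)
      (𝓝 (∑ i ∈ I, ⟪i.1, u⟫_ℝ * ∫ x in P ∩ {x | ⟪i.1, x⟫_ℝ = i.2}, φ x ∂μHE[k])) := by
    refine tendsto_finsetSum _ fun i hi => Tendsto.const_mul _ ?_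
    refine tendsto_integral_collar (hI i hi) i.2 hφ.continuous hφc
      (ρ := fun s x => ∏ j ∈ I.erase i, η j s x) (hprodc _) (hprod1 _)
      (N := ⋃ j ∈ I.erase i, {x | ⟪i.1, x⟫_ℝ = i.2 ∧ ⟪j.1, x⟫_ℝ = j.2}) inter_subset_right
      (hPm.inter (isClosed_eq (by fun_prop) continuous_const).measurableSet) ?_ ?_ ?_
    · intro x hx
      simp only [mem_iUnion] at hx
      obtain ⟨j, _, hx⟩ := hx
      exact hx.1
    · refine (measure_biUnion_null_iff (I.erase i).countable_toSet).2 fun j hj => ?_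
      have hj' := Finset.mem_erase.1 hj
      obtain ⟨p, hp, hp'⟩ := exists_mem_hyperplane_inner_ne (hI i hi) (hI j hj'.2) (hv i hi)
        (hv j hj'.2) (fun h => hj'.1 h.symm)
      exact hausdorff_eq_zero_of_subset_hyperplanes (hI i hi) hp hp' (fun x hx => hx.1)
        (fun x hx => hx.2)
    · intro p hp hpN τ
      have hpj : ∀ j ∈ I.erase i, ⟪j.1, p⟫_ℝ ≠ j.2 := by
        intro j hj h
        exact hpN (mem_biUnion hj ⟨hp, h⟩)
      have h := hlimprod (I.erase i) p (τ • i.1)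
        (fun j hj => Or.inl (sub_ne_zero.2 (hpj j hj).symm))
      simp only [smul_smul] at h
      convert h using 2
      by_cases hpP : p ∈ P
      · rw [indicator_of_mem (show p ∈ P ∩ {x | ⟪i.1, x⟫_ℝ = i.2} from ⟨hpP, hp⟩), Finset.prod_eq_one, Pi.one_apply]
        intro j hj
        rw [if_pos]
        exact sub_pos.2 (lt_of_le_of_ne (hpP j (Finset.mem_erase.1 hj).2) (hpj j hj))
      · rw [indicator_of_notMem (fun h => hpP h.1)]
        have : ∃ j ∈ I, j.2 < ⟪j.1, p⟫_ℝ := by simpa [hP] using hpP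
        obtain ⟨j, hj, hpj⟩ := this
        have hji : j ≠ i := by rintro rfl; linarith
        rw [Finset.prod_eq_zero (Finset.mem_erase.2 ⟨hji, hj⟩)]
        rw [if_neg]
        linarith
  refine tendsto_nhds_unique hL ?_
  simp only [hparts]
  exact hR

end Divergence

/-! ### Separation of tiles, and tiles as intersections of half-spaces -/

theorem inner_lt_of_mem_interior {E : Type*} [NormedAddCommGroup E] [InnerProductSpace ℝ E]
    {S : Set E} {n v : E} {c : ℝ} (hn : ‖n‖ = 1) (hS : ∀ x ∈ S, ⟪n, x⟫_ℝ ≤ c)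
    (hv : v ∈ interior S) : ⟪n, v⟫_ℝ < c := by
  obtain ⟨r, hr, hball⟩ := Metric.isOpen_iff.1 isOpen_interior v hv
  have h := hS (v + (r / 2) • n) (interior_subset (hball (by
    rw [mem_ball_iff_norm, add_sub_cancel_left, norm_smul, hn, Real.norm_eq_abs,
      abs_of_pos (by linarith)]
    linarith)))
  rw [inner_add_right, inner_smul_right, real_inner_self_eq_norm_sq, hn] at h
  linarith

namespace Tiling

variable {k : ℕ} {D : Set (EuclideanSpace ℝ (Fin (k + 1)))} (G : Tiling (k + 1) D)
variable {v w : EuclideanSpace ℝ (Fin (k + 1))}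

theorem convex_tile (hv : v ∈ G.verts) : Convex ℝ (G.tile v) := by
  obtain ⟨s, -, hs⟩ := G.isPolytope v hv
  rw [hs]; exact convex_convexHull ℝ s

theorem isCompact_tile (hv : v ∈ G.verts) : IsCompact (G.tile v) := by
  obtain ⟨s, hf, hs⟩ := G.isPolytope v hv
  rw [hs]; exact hf.isCompact_convexHull ℝ

theorem mem_tile (hv : v ∈ G.verts) : v ∈ G.tile v := interior_subset (G.mem_interior v hv)

/-- The hyperplane `{⟪n, x⟫ = c}` separates the tile of `v` from the tile of `w`. -/
structure Separates (n : EuclideanSpace ℝ (Fin (k + 1))) (c : ℝ)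
    (v w : EuclideanSpace ℝ (Fin (k + 1))) : Prop where
  norm_eq : ‖n‖ = 1
  le : ∀ x ∈ G.tile v, ⟪n, x⟫_ℝ ≤ c
  ge : ∀ x ∈ G.tile w, c ≤ ⟪n, x⟫_ℝ
  lt : ⟪n, v⟫_ℝ < c
  gt : c < ⟪n, w⟫_ℝ

variable {G}

theorem Separates.symm {n : EuclideanSpace ℝ (Fin (k + 1))} {c : ℝ} (h : G.Separates n c v w) :
    G.Separates (-n) (-c) w v where
  norm_eq := by rw [norm_neg, h.norm_eq]
  le x hx := by rw [inner_neg_left]; linarith [h.ge x hx]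
  ge x hx := by rw [inner_neg_left]; linarith [h.le x hx]
  lt := by rw [inner_neg_left]; linarith [h.gt]
  gt := by rw [inner_neg_left]; linarith [h.lt]

theorem Separates.inner_eq {n : EuclideanSpace ℝ (Fin (k + 1))} {c : ℝ}
    (h : G.Separates n c v w) {x : EuclideanSpace ℝ (Fin (k + 1))} (hv : x ∈ G.tile v)
    (hw : x ∈ G.tile w) : ⟪n, x⟫_ℝ = c :=
  le_antisymm (h.le x hv) (h.ge x hw)

variable (G)

theorem exists_separates (hv : v ∈ G.verts) (hw : w ∈ G.verts) (hvw : v ≠ w) :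
    ∃ n c, G.Separates n c v w := by
  obtain ⟨f, c, hf, h1, h2⟩ := geometric_hahn_banach_of_nonempty_interior (G.convex_tile hv)
    (G.convex_tile hw).interior (G.disjoint_interior v hv w hw hvw) ⟨v, G.mem_interior v hv⟩
    ⟨w, G.mem_interior w hw⟩
  have h2' : ∀ x ∈ G.tile w, c ≤ f x := by
    have hcl : IsClosed {x | c ≤ f x} := isClosed_le continuous_const f.continuous
    have := closure_minimal (fun x hx => h2 x hx) hcl
    rw [(G.convex_tile hw).closure_interior_eq_closure_of_nonempty_interior
      ⟨w, G.mem_interior w hw⟩] at this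
    exact fun x hx => this (subset_closure hx)
  obtain ⟨m, rfl⟩ := (InnerProductSpace.toDual ℝ (EuclideanSpace ℝ (Fin (k + 1)))).surjective f
  simp only [InnerProductSpace.toDual_apply_apply] at h1 h2'
  have hm : 0 < ‖m‖ := by
    rw [norm_pos_iff]; rintro rfl; simp at hf
  have hn : ‖(‖m‖⁻¹ • m)‖ = 1 := norm_smul_inv_norm (𝕜 := ℝ) (norm_pos_iff.1 hm)
  have hle : ∀ x ∈ G.tile v, ⟪‖m‖⁻¹ • m, x⟫_ℝ ≤ ‖m‖⁻¹ * c := fun x hx => by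
    rw [real_inner_smul_left]; gcongr; exact h1 x hx
  have hge : ∀ x ∈ G.tile w, ‖m‖⁻¹ * c ≤ ⟪‖m‖⁻¹ • m, x⟫_ℝ := fun x hx => by
    rw [real_inner_smul_left]; gcongr; exact h2' x hx
  refine ⟨‖m‖⁻¹ • m, ‖m‖⁻¹ * c, hn, hle, hge,
    inner_lt_of_mem_interior hn hle (G.mem_interior v hv), ?_⟩
  have := inner_lt_of_mem_interior (n := -(‖m‖⁻¹ • m)) (c := -(‖m‖⁻¹ * c)) (by rw [norm_neg, hn])
    (fun x hx => by rw [inner_neg_left]; linarith [hge x hx]) (G.mem_interior w hw)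
  rw [inner_neg_left] at this
  linarith

theorem facet_comm (w v : EuclideanSpace ℝ (Fin (k + 1))) : G.facet w v = G.facet v w :=
  inter_comm _ _

variable {G}

theorem Adj.symm (h : G.Adj w v) : G.Adj v w := by
  obtain ⟨h1, h2, h3, h4, h5⟩ := h
  rw [facet_comm] at h4 h5
  exact ⟨h2, h1, h3.symm, h4, h5⟩

theorem Adj.convex_facet (h : G.Adj w v) : Convex ℝ (G.facet w v) :=
  (G.convex_tile h.1).inter (G.convex_tile h.2.1)

theorem Adj.isCompact_facet (h : G.Adj w v) : IsCompact (G.facet w v) :=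
  (G.isCompact_tile h.1).inter (G.isCompact_tile h.2.1)

theorem Separates.facet_subset {n : EuclideanSpace ℝ (Fin (k + 1))} {c : ℝ}
    (h : G.Separates n c v w) : ∀ x ∈ G.facet w v, ⟪n, x⟫_ℝ = c :=
  fun _ hx => h.inner_eq hx.2 hx.1

/-- The facet spans a `k`-dimensional direction inside the complement of `n`, hence all of it, so
orthogonality makes `w - v` a multiple of `n`. Strict separation of the labels fixes the sign. -/
theorem Separates.normal_eq (hG : G.IsOrthogonal) (h : G.Adj w v)
    {n : EuclideanSpace ℝ (Fin (k + 1))} {c : ℝ} (hs : G.Separates n c v w) :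
    w - v = ‖w - v‖ • n := by
  have hn0 : n ≠ 0 := by rintro rfl; simpa using hs.norm_eq
  have : Fact (Module.finrank ℝ (EuclideanSpace ℝ (Fin (k + 1))) = k + 1) := ⟨by simp⟩
  have hdir : (affineSpan ℝ (G.facet w v)).direction = (ℝ ∙ n)ᗮ := by
    apply Submodule.eq_of_le_of_finrank_eq
    · rw [direction_affineSpan, vectorSpan_def, Submodule.span_le]
      rintro _ ⟨x, hx, y, hy, rfl⟩
      simp only [SetLike.mem_coe, Submodule.mem_orthogonal_singleton_iff_inner_right, vsub_eq_sub,
        inner_sub_right]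
      rw [hs.facet_subset x hx, hs.facet_subset y hy, sub_self]
    · rw [Submodule.finrank_orthogonal_span_singleton (n := k) hn0]
      exact Nat.succ_injective h.2.2.2.2
  have hmem : w - v ∈ ((ℝ ∙ n)ᗮ)ᗮ := by
    rw [← hdir, Submodule.mem_orthogonal']
    exact fun u hu => hG w v h u hu
  rw [Submodule.orthogonal_orthogonal, Submodule.mem_span_singleton] at hmem
  obtain ⟨t, ht⟩ := hmem
  have ht0 : 0 < t := by
    have h1 : ⟪n, w - v⟫_ℝ = t := by
      rw [← ht, inner_smul_right, real_inner_self_eq_norm_sq, hs.norm_eq]; ring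
    rw [← h1, inner_sub_right]
    linarith [hs.lt, hs.gt]
  rw [← ht, norm_smul, hs.norm_eq, mul_one, Real.norm_eq_abs, abs_of_pos ht0]

variable (G)

/-- The common points lie on the separating hyperplanes of all three pairs, and two of these differ:
if one hyperplane separates `v` from both `w` and `z`, it does not separate `w` from `z`. -/
theorem hausdorff_triple_eq_zero {z : EuclideanSpace ℝ (Fin (k + 1))} (hv : v ∈ G.verts)
    (hw : w ∈ G.verts) (hz : z ∈ G.verts) (hvw : v ≠ w) (hvz : v ≠ z) (hwz : w ≠ z) :
    μHE[k] (G.tile v ∩ (G.tile w ∩ G.tile z)) = 0 := by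
  obtain ⟨n, c, h⟩ := G.exists_separates hv hw hvw
  obtain ⟨n', c', h'⟩ := G.exists_separates hv hz hvz
  obtain ⟨n'', c'', h''⟩ := G.exists_separates hw hz hwz
  by_cases h1 : (n, c) = (n', c')
  · have h2 : (-n, -c) ≠ (n'', c'') := by
      intro h2
      simp only [Prod.mk.injEq] at h1 h2
      obtain ⟨rfl, rfl⟩ := h1
      obtain ⟨rfl, rfl⟩ := h2
      have := h''.gt
      rw [inner_neg_left] at this
      linarith [h'.gt]
    obtain ⟨p, hp, hp'⟩ := exists_mem_hyperplane_inner_ne h.symm.norm_eq h''.norm_eq h.symm.lt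
      h''.lt h2
    exact hausdorff_eq_zero_of_subset_hyperplanes h.symm.norm_eq hp hp'
      (fun x hx => h.symm.inner_eq hx.2.1 hx.1) (fun x hx => h''.inner_eq hx.2.1 hx.2.2)
  · obtain ⟨p, hp, hp'⟩ := exists_mem_hyperplane_inner_ne h.norm_eq h'.norm_eq h.lt h'.lt h1
    exact hausdorff_eq_zero_of_subset_hyperplanes h.norm_eq hp hp'
      (fun x hx => h.inner_eq hx.1 hx.2.1) (fun x hx => h'.inner_eq hx.1 hx.2.2)

theorem volume_tile_inter_tile (hv : v ∈ G.verts) (hw : w ∈ G.verts) (hvw : v ≠ w) :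
    volume (G.tile v ∩ G.tile w) = 0 := by
  obtain ⟨n, c, h⟩ := G.exists_separates hv hw hvw
  refine measure_mono_null (fun x hx => ?_)
    (volume_setOf_linearMap_eq (l := innerₛₗ ℝ n) (fun h0 => ?_) c)
  · exact h.inner_eq hx.1 hx.2
  · have h1 := LinearMap.congr_fun h0 n
    have h2 := h.norm_eq
    simp at h1
    simp [h1] at h2

/-- The vertices of the tiles which touch the tile of `v`. -/
def touching (v : EuclideanSpace ℝ (Fin (k + 1))) : Set (EuclideanSpace ℝ (Fin (k + 1))) :=
  {w | w ∈ G.verts ∧ w ≠ v ∧ (G.tile w ∩ G.tile v).Nonempty}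

theorem finite_touching (hv : v ∈ G.verts) (hvD : G.tile v ⊆ interior D) :
    (G.touching v).Finite :=
  (G.locallyFinite _ (hvD.trans interior_subset) (G.isCompact_tile hv)).subset
    fun _ hw => ⟨hw.1, hw.2.2⟩

/-- Near `y` the complement of the tile is covered by finitely many other tiles. Their union is
closed and therefore contains its limit point `y`. -/
theorem exists_touching_of_notMem_interior (hvD : G.tile v ⊆ interior D)
    {y : EuclideanSpace ℝ (Fin (k + 1))} (hy : y ∈ G.tile v) (hyi : y ∉ interior (G.tile v)) :
    ∃ w ∈ G.touching v, y ∈ G.tile w := by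
  obtain ⟨r, hr, hrD⟩ := Metric.nhds_basis_closedBall.mem_iff.1
    (mem_interior_iff_mem_nhds.1 (hvD hy))
  have hfin := G.locallyFinite _ hrD (isCompact_closedBall y r)
  set N := {w | w ∈ G.verts ∧ (G.tile w ∩ Metric.closedBall y r).Nonempty} \ {v} with hN
  have hNfin : N.Finite := hfin.subset sdiff_subset
  have hclosed : IsClosed (⋃ w ∈ N, G.tile w) :=
    hNfin.isClosed_biUnion fun w hw => (G.isCompact_tile hw.1.1).isClosed
  have hsub : (G.tile v)ᶜ ∩ Metric.ball y r ⊆ ⋃ w ∈ N, G.tile w := by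
    rintro x ⟨hxv, hxr⟩
    have hxr' := Metric.ball_subset_closedBall hxr
    obtain ⟨w, hw, hxw⟩ := mem_iUnion₂.1 (G.cover (hrD hxr'))
    refine mem_biUnion ⟨⟨hw, x, hxw, hxr'⟩, ?_⟩ hxw
    rintro rfl
    exact hxv hxw
  have hycl : y ∈ closure ((G.tile v)ᶜ ∩ Metric.ball y r) := by
    rw [inter_comm]
    refine mem_closure_iff_nhds.2 fun t ht => ?_
    have h1 : y ∈ closure (G.tile v)ᶜ := by rwa [closure_compl]
    obtain ⟨x, hx, hx'⟩ := mem_closure_iff_nhds.1 h1 _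
      (Filter.inter_mem ht (Metric.ball_mem_nhds y hr))
    exact ⟨x, hx.1, hx.2, hx'⟩
  obtain ⟨w, hw, hyw⟩ := mem_iUnion₂.1 (closure_minimal hsub hclosed hycl)
  exact ⟨w, ⟨hw.1.1, hw.2, y, hyw, hy⟩, hyw⟩

/-- The open polytope `Q` is connected and contains `v`. It cannot cross the boundary of the tile,
since a boundary point lies in a touching tile and so beyond its hyperplane. Contracting towards `v`
shows that the closed polytope lies in the closure of `Q`. -/
theorem tile_eq_polytope (hv : v ∈ G.verts) (hvD : G.tile v ⊆ interior D)
    {T : Set (EuclideanSpace ℝ (Fin (k + 1)))} (hT : G.touching v = T)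
    {n : EuclideanSpace ℝ (Fin (k + 1)) → EuclideanSpace ℝ (Fin (k + 1))}
    {c : EuclideanSpace ℝ (Fin (k + 1)) → ℝ} (h : ∀ w ∈ T, G.Separates (n w) (c w) v w) :
    G.tile v = {x | ∀ w ∈ T, ⟪n w, x⟫_ℝ ≤ c w} := by
  apply Subset.antisymm
  · exact fun x hx w hw => (h w hw).le x hx
  set Q := {x | ∀ w ∈ T, ⟪n w, x⟫_ℝ < c w} with hQ
  have hQsub : Q ⊆ interior (G.tile v) := by
    have hQc : Convex ℝ Q := by
      have : Q = ⋂ w ∈ T, {x | ⟪n w, x⟫_ℝ < c w} := by ext; simp [hQ]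
      rw [this]
      exact convex_iInter₂ fun w _ => convex_halfSpace_lt (innerₛₗ ℝ (n w)).isLinear (c w)
    refine hQc.isPreconnected.subset_left_of_subset_union isOpen_interior
      (G.isCompact_tile hv).isClosed.isOpen_compl
      (disjoint_compl_right.mono_left interior_subset) ?_
      ⟨v, fun w hw => (h w hw).lt, G.mem_interior v hv⟩
    intro x hx
    by_cases hxv : x ∈ G.tile v
    · left
      by_contra hxi
      obtain ⟨w, hw, hxw⟩ := G.exists_touching_of_notMem_interior hvD hxv hxi
      rw [hT] at hw
      exact absurd ((h w hw).ge x hxw) (not_le.2 (hx w hw))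
    · right; exact hxv
  intro x hx
  have hcl : x ∈ closure Q := by
    have hlim : Filter.Tendsto (fun t : ℝ => AffineMap.lineMap v x t) (nhdsWithin 1 (Iio 1))
        (nhds x) := by
      have : Filter.Tendsto (fun t : ℝ => AffineMap.lineMap v x t) (nhds 1)
          (nhds (AffineMap.lineMap v x (1 : ℝ))) :=
        (AffineMap.lineMap_continuous (p := v) (q := x)).tendsto 1
      rw [AffineMap.lineMap_apply_one] at this
      exact this.mono_left nhdsWithin_le_nhds
    refine mem_closure_of_tendsto hlim ?_
    filter_upwards [Ioo_mem_nhdsLT (zero_lt_one' ℝ)] with t ht w hw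
    rw [AffineMap.lineMap_apply, vsub_eq_sub, vadd_eq_add, inner_add_right, inner_smul_right,
      inner_sub_right]
    nlinarith [hx w hw, (h w hw).lt, ht.1, ht.2]
  exact closure_minimal (hQsub.trans interior_subset) (G.isCompact_tile hv).isClosed hcl

end Tiling

/-! ### The divergence theorem on a tile -/

open scoped Manifold in
theorem exists_contDiff_hasCompactSupport_eventuallyEq {E : Type*} [NormedAddCommGroup E]
    [InnerProductSpace ℝ E] [FiniteDimensional ℝ E] {K : Set E} (hK : IsCompact K) {φ : E → ℝ}
    (hφ : ∀ x ∈ K, ContDiffAt ℝ 1 φ x) :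
    ∃ ψ : E → ℝ, ContDiff ℝ 1 ψ ∧ HasCompactSupport ψ ∧ ∀ x ∈ K, ψ =ᶠ[nhds x] φ := by
  have hO : IsOpen {x | ContDiffAt ℝ 1 φ x} :=
    isOpen_iff_mem_nhds.2 fun x hx =>
    ContDiffAt.eventually (show ContDiffAt ℝ 1 φ x from hx) (by simp)
  obtain ⟨L, hL, hKL, hLO⟩ := exists_compact_between hK hO hφ
  obtain ⟨f, hf1, hf0, -⟩ := exists_contMDiffMap_one_nhds_of_subset_interior (n := 1) 𝓘(ℝ, E)
    hK.isClosed hKL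
  have hfs : ContDiff ℝ 1 f := f.contMDiff.contDiff
  have hsupp : ∀ x ∉ L, f x * φ x = 0 := fun x hx => by rw [hf0 x hx, zero_mul]
  refine ⟨fun x => f x * φ x, ?_, HasCompactSupport.intro hL hsupp, fun x hx => ?_⟩
  · rw [contDiff_iff_contDiffAt]
    intro x
    by_cases hx : x ∈ L
    · exact hfs.contDiffAt.mul (hLO hx)
    · refine (contDiffAt_const (c := (0 : ℝ))).congr_of_eventuallyEq ?_
      filter_upwards [hL.isClosed.isOpen_compl.mem_nhds hx] with y hy using hsupp y hy
  · filter_upwards [(eventually_nhdsSet_iff_forall.1 hf1) x hx] with y hy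
    rw [hy, one_mul]

namespace Tiling

variable {k : ℕ} {D : Set (EuclideanSpace ℝ (Fin (k + 1)))} (G : Tiling (k + 1) D)
variable {v : EuclideanSpace ℝ (Fin (k + 1))}

/-- A face of the tile as a polytope may be shared by several neighbours. Up to null sets it is the
disjoint union of their facets, and touching tiles that are not adjacent contribute nothing. -/
theorem integral_tile_fderiv_of_contDiff (hG : G.IsOrthogonal) (hv : v ∈ G.verts)
    (hvD : G.tile v ⊆ interior D) {N : Finset (EuclideanSpace ℝ (Fin (k + 1)))}
    (hN : ∀ w, w ∈ N ↔ G.Adj w v) {φ : EuclideanSpace ℝ (Fin (k + 1)) → ℝ}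
    (hφ : ContDiff ℝ 1 φ) (hφc : HasCompactSupport φ) (u : EuclideanSpace ℝ (Fin (k + 1))) :
    ∫ x in G.tile v, fderiv ℝ φ x u =
      ∑ w ∈ N, ‖w - v‖⁻¹ * ⟪w - v, u⟫_ℝ * ∫ x in G.facet w v, φ x ∂μHE[k] := by
  classical
  obtain ⟨T, hT⟩ := (G.finite_touching hv hvD).exists_finset_coe
  have hTmem : ∀ w, w ∈ T ↔ w ∈ G.touching v := fun w => by rw [← hT]; simp
  have hsep : ∀ w, ∃ n c, w ∈ T → G.Separates n c v w := fun w => by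
    by_cases hw : w ∈ T
    · have hw' := (hTmem w).1 hw
      obtain ⟨n, c, h⟩ := G.exists_separates hv hw'.1 hw'.2.1.symm
      exact ⟨n, c, fun _ => h⟩
    · exact ⟨0, 0, fun h => absurd h hw⟩
  choose n c hs using hsep
  -- Taking the image merges the touching tiles that lie behind the same hyperplane.
  set I := T.image fun w => (n w, c w) with hI
  have hIs : ∀ i ∈ I, ∃ w ∈ T, i = (n w, c w) := fun i hi => by
    obtain ⟨w, hw, rfl⟩ := Finset.mem_image.1 hi
    exact ⟨w, hw, rfl⟩
  have htile : G.tile v = {x | ∀ i ∈ I, ⟪i.1, x⟫_ℝ ≤ i.2} := by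
    rw [G.tile_eq_polytope hv hvD hT.symm hs]
    ext x
    simp [hI]
  have hI1 : ∀ i ∈ I, ‖i.1‖ = 1 := fun i hi => by
    obtain ⟨w, hw, rfl⟩ := hIs i hi
    exact (hs w hw).norm_eq
  have hIv : ∀ i ∈ I, ⟪i.1, v⟫_ℝ < i.2 := fun i hi => by
    obtain ⟨w, hw, rfl⟩ := hIs i hi
    exact (hs w hw).lt
  have hverts : ∀ w ∈ T, w ∈ G.verts ∧ w ≠ v := fun w hw =>
    ⟨((hTmem w).1 hw).1, ((hTmem w).1 hw).2.1⟩
  have hfcompact : ∀ w ∈ T, IsCompact (G.facet w v) := fun w hw =>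
    (G.isCompact_tile (hverts w hw).1).inter (G.isCompact_tile hv)
  have hface : ∀ i ∈ I, ∫ x in G.tile v ∩ {x | ⟪i.1, x⟫_ℝ = i.2}, φ x ∂μHE[k] =
      ∑ w ∈ T with (n w, c w) = i, ∫ x in G.facet w v, φ x ∂μHE[k] := by
    intro i hi
    set Ti := T.filter fun w => (n w, c w) = i with hTi
    have hTiT : ∀ w ∈ Ti, w ∈ T ∧ (n w, c w) = i := fun w hw => Finset.mem_filter.1 hw
    have hae : (⋃ w : Ti, G.facet w.1 v) =ᵐ[μHE[k]]
        (G.tile v ∩ {x | ⟪i.1, x⟫_ℝ = i.2} : Set (EuclideanSpace ℝ (Fin (k + 1)))) := by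
      refine Filter.EventuallyLE.antisymm ?_ ?_
      · rw [ae_le_set, sdiff_eq_empty.2, measure_empty]
        refine iUnion_subset fun w x hx => ⟨hx.2, ?_⟩
        obtain ⟨hw, hwi⟩ := hTiT w.1 w.2
        rw [← hwi]
        exact (hs w.1 hw).facet_subset x hx
      · rw [ae_le_set]
        refine measure_mono_null (t := ⋃ j ∈ I.erase i,
          {x | ⟪i.1, x⟫_ℝ = i.2 ∧ ⟪j.1, x⟫_ℝ = j.2}) ?_
          ((measure_biUnion_null_iff (I.erase i).countable_toSet).2 fun j hj => ?_)
        · rintro x ⟨⟨hxv, hxi⟩, hxU⟩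
          by_contra hxN
          have hlt : ∀ j ∈ I, j ≠ i → ⟪j.1, x⟫_ℝ < j.2 := by
            intro j hj hji
            refine lt_of_le_of_ne ?_ fun h => hxN
              (mem_biUnion (Finset.mem_erase.2 ⟨hji, hj⟩) ⟨hxi, h⟩)
            rw [htile] at hxv
            exact hxv j hj
          have hxint : x ∉ interior (G.tile v) := fun h =>
            absurd hxi (inner_lt_of_mem_interior (hI1 i hi)
              (fun y hy => by rw [htile] at hy; exact hy i hi) h).ne
          obtain ⟨w, hw, hxw⟩ := G.exists_touching_of_notMem_interior hvD hxv hxint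
          rw [← hTmem] at hw
          by_cases hwi : (n w, c w) = i
          · exact hxU (mem_iUnion.2 ⟨⟨w, Finset.mem_filter.2 ⟨hw, hwi⟩⟩, hxw, hxv⟩)
          · have h1 := hlt _ (Finset.mem_image_of_mem _ hw) hwi
            have h2 := (hs w hw).ge x hxw
            simp only at h1
            linarith
        · have hj' := Finset.mem_erase.1 hj
          obtain ⟨p, hp, hp'⟩ := exists_mem_hyperplane_inner_ne (hI1 i hi) (hI1 j hj'.2)
            (hIv i hi) (hIv j hj'.2) (fun h => hj'.1 h.symm)
          exact hausdorff_eq_zero_of_subset_hyperplanes (hI1 i hi) hp hp' (fun x hx => hx.1)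
            (fun x hx => hx.2)
    rw [← setIntegral_congr_set hae, integral_iUnion_ae, tsum_fintype,
      Finset.sum_coe_sort Ti fun w => ∫ x in G.facet w v, φ x ∂μHE[k]]
    · exact fun w => (hfcompact w.1 (hTiT w.1 w.2).1).isClosed.measurableSet.nullMeasurableSet
    · intro w w' hww'
      have hw := hverts w.1 (hTiT w.1 w.2).1
      have hw' := hverts w'.1 (hTiT w'.1 w'.2).1
      refine measure_mono_null ?_ (G.hausdorff_triple_eq_zero hv hw.1 hw'.1 hw.2.symm hw'.2.symm
        (fun h => hww' (Subtype.ext h)))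
      exact fun x hx => ⟨hx.1.2, hx.1.1, hx.2.1⟩
    · rw [integrableOn_finite_iUnion]
      intro w
      have hw := (hTiT w.1 w.2).1
      refine hφ.continuous.continuousOn.integrableOn_of_subset_isCompact (hfcompact _ hw)
        (hfcompact _ hw).isClosed.measurableSet Subset.rfl ?_
      obtain ⟨A, hA, -⟩ := exists_hyperplane_coordinates (hs w.1 hw).norm_eq
      rw [hausdorff_eq_volume_coordinates (hs w.1 hw).norm_eq hA (hs w.1 hw).facet_subset]
      exact ((isometry_coordinates _).isClosedEmbedding.isCompact_preimage
        (hfcompact _ hw)).measure_ne_top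
  have hNT : N ⊆ T := fun w hw => by
    have h := (hN w).1 hw
    exact (hTmem w).2 ⟨h.1, h.2.2.1, h.2.2.2.1⟩
  have hdiv := integral_polytope_fderiv hI1 hIv hφ hφc u
  rw [← htile] at hdiv
  rw [hdiv]
  calc ∑ i ∈ I, ⟪i.1, u⟫_ℝ * ∫ x in G.tile v ∩ {x | ⟪i.1, x⟫_ℝ = i.2}, φ x ∂μHE[k]
      = ∑ i ∈ I, ∑ w ∈ T with (n w, c w) = i, ⟪n w, u⟫_ℝ * ∫ x in G.facet w v, φ x ∂μHE[k] := by
        refine Finset.sum_congr rfl fun i hi => ?_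
        rw [hface i hi, Finset.mul_sum]
        refine Finset.sum_congr rfl fun w hw => ?_
        rw [← (Finset.mem_filter.1 hw).2]
    _ = ∑ w ∈ T, ⟪n w, u⟫_ℝ * ∫ x in G.facet w v, φ x ∂μHE[k] :=
        Finset.sum_fiberwise_of_maps_to (fun w hw => Finset.mem_image_of_mem _ hw) _
    _ = ∑ w ∈ N, ⟪n w, u⟫_ℝ * ∫ x in G.facet w v, φ x ∂μHE[k] := by
        refine (Finset.sum_subset hNT fun w hw hwN => ?_).symm
        have h0 : μHE[k] (G.facet w v) = 0 := by
          refine hausdorff_eq_zero_of_finrank_ne (hs w hw).norm_eq (hs w hw).facet_subset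
            fun hne hrank => hwN ((hN w).2 ⟨(hverts w hw).1, hv, (hverts w hw).2, hne, ?_⟩)
          rw [hrank]
        rw [Measure.restrict_eq_zero.2 h0, integral_zero_measure, mul_zero]
    _ = _ := by
        refine Finset.sum_congr rfl fun w hw => ?_
        have hadj := (hN w).1 hw
        have hpos : ‖w - v‖ ≠ 0 := norm_ne_zero_iff.2 (sub_ne_zero.2 hadj.2.2.1)
        have h1 := (hs w (hNT hw)).normal_eq hG hadj
        rw [show ⟪w - v, u⟫_ℝ = ‖w - v‖ * ⟪n w, u⟫_ℝ by
          conv_lhs => rw [h1]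
          rw [real_inner_smul_left], inv_mul_cancel_left₀ hpos]

/-- The divergence theorem on a tile, for the fields which point in a fixed direction. -/
theorem integral_tile_fderiv (hG : G.IsOrthogonal) (hv : v ∈ G.verts)
    (hvD : G.tile v ⊆ interior D) {N : Finset (EuclideanSpace ℝ (Fin (k + 1)))}
    (hN : ∀ w, w ∈ N ↔ G.Adj w v) {φ : EuclideanSpace ℝ (Fin (k + 1)) → ℝ}
    (hφ : ∀ x ∈ G.tile v, ContDiffAt ℝ 1 φ x) (u : EuclideanSpace ℝ (Fin (k + 1))) :
    ∫ x in G.tile v, fderiv ℝ φ x u =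
      ∑ w ∈ N, ‖w - v‖⁻¹ * ⟪w - v, u⟫_ℝ * ∫ x in G.facet w v, φ x ∂μHE[k] := by
  obtain ⟨ψ, hψ, hψc, hψφ⟩ := exists_contDiff_hasCompactSupport_eventuallyEq
    (G.isCompact_tile hv) hφ
  have hm := (G.isCompact_tile hv).isClosed.measurableSet
  have h := G.integral_tile_fderiv_of_contDiff hG hv hvD hN hψ hψc u
  rw [setIntegral_congr_fun hm fun x hx => by rw [← (hψφ x hx).fderiv_eq], h]
  refine Finset.sum_congr rfl fun w hw => ?_
  rw [setIntegral_congr_fun ((hN w).1 hw).isCompact_facet.isClosed.measurableSet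
    fun x hx => (hψφ x hx.2).eq_of_nhds]

end Tiling

/-! ### Conductances, cone volumes and vanishing fluxes -/

namespace Tiling

variable {k : ℕ} {D : Set (EuclideanSpace ℝ (Fin (k + 1)))} (G : Tiling (k + 1) D)
variable {v w : EuclideanSpace ℝ (Fin (k + 1))}

theorem cond_eq (w v : EuclideanSpace ℝ (Fin (k + 1))) :
    G.cond w v = μHE[k].real (G.facet w v) / ‖w - v‖ := rfl

theorem cond_comm (w v : EuclideanSpace ℝ (Fin (k + 1))) : G.cond w v = G.cond v w := by
  rw [cond_eq, cond_eq, facet_comm, norm_sub_rev]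

theorem cond_nonneg (w v : EuclideanSpace ℝ (Fin (k + 1))) : 0 ≤ G.cond w v :=
  div_nonneg measureReal_nonneg (norm_nonneg _)

variable {G}

theorem Adj.norm_pos (h : G.Adj w v) : 0 < ‖w - v‖ := norm_pos_iff.2 (sub_ne_zero.2 h.2.2.1)

theorem Adj.hausdorff_facet_ne_top (h : G.Adj w v) : μHE[k] (G.facet w v) ≠ ⊤ := by
  obtain ⟨n, c, hs⟩ := G.exists_separates h.2.1 h.1 h.2.2.1.symm
  obtain ⟨A, hA, -⟩ := exists_hyperplane_coordinates hs.norm_eq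
  rw [hausdorff_eq_volume_coordinates hs.norm_eq hA hs.facet_subset]
  exact ((isometry_coordinates _).isClosedEmbedding.isCompact_preimage
    h.isCompact_facet).measure_ne_top

theorem Adj.integrableOn_facet (h : G.Adj w v) {φ : EuclideanSpace ℝ (Fin (k + 1)) → ℝ}
    (hφ : ContinuousOn φ (G.facet w v)) : IntegrableOn φ (G.facet w v) μHE[k] :=
  hφ.integrableOn_of_subset_isCompact h.isCompact_facet h.isCompact_facet.isClosed.measurableSet
    Subset.rfl h.hausdorff_facet_ne_top

theorem Adj.measurableSet_cone (h : G.Adj w v) (p : EuclideanSpace ℝ (Fin (k + 1))) :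
    MeasurableSet (convexHull ℝ (insert p (G.facet w v))) :=
  (isCompact_convexHull_insert h.isCompact_facet h.convex_facet p).isClosed.measurableSet

theorem Adj.volume_cone_ne_top (h : G.Adj w v) (p : EuclideanSpace ℝ (Fin (k + 1))) :
    volume (convexHull ℝ (insert p (G.facet w v))) ≠ ⊤ :=
  (isCompact_convexHull_insert h.isCompact_facet h.convex_facet p).measure_ne_top

theorem Separates.volume_cone {n : EuclideanSpace ℝ (Fin (k + 1))} {c : ℝ}
    (hs : G.Separates n c v w) (h : G.Adj w v) :
    volume.real (convexHull ℝ (insert v (G.facet w v))) =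
      (c - ⟪n, v⟫_ℝ) / (k + 1) * μHE[k].real (G.facet w v) := by
  rw [measureReal_def, volume_convexHull_insert hs.norm_eq hs.lt h.convex_facet h.isCompact_facet
    hs.facet_subset h.2.2.2.1, ENNReal.toReal_mul, ENNReal.toReal_ofReal, measureReal_def]
  exact div_nonneg (by linarith [hs.lt]) (by positivity)

/-- Since `w - v` is normal to the facet, the heights of the two cones add up to `‖w - v‖`. The
segment from `v` to `w` need not meet the facet. -/
theorem Adj.cond_mul_sq (hG : G.IsOrthogonal) (h : G.Adj w v) :
    G.cond w v * ‖w - v‖ ^ 2 = (k + 1) * (volume.real (convexHull ℝ (insert v (G.facet w v))) +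
      volume.real (convexHull ℝ (insert w (G.facet w v)))) := by
  obtain ⟨n, c, hs⟩ := G.exists_separates h.2.1 h.1 h.2.2.1.symm
  have h1 := hs.volume_cone h
  have h2 := hs.symm.volume_cone h.symm
  rw [facet_comm, inner_neg_left] at h2
  have h3 : ⟪n, w⟫_ℝ - ⟪n, v⟫_ℝ = ‖w - v‖ := by
    rw [← inner_sub_right, hs.normal_eq hG h, inner_smul_right, real_inner_self_eq_norm_sq,
      hs.norm_eq, norm_smul, hs.norm_eq]
    simp
  have h4 := h.norm_pos
  rw [h1, h2, cond_eq]
  have h5 : (k + 1 : ℝ) ≠ 0 := by positivity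
  rw [← h3] at h4 ⊢
  field_simp
  ring

theorem Adj.volume_dualPolytope_le (hG : G.IsOrthogonal) (h : G.Adj w v) :
    volume.real (G.dualPolytope w v) ≤ G.cond w v * ‖w - v‖ ^ 2 := by
  rw [h.cond_mul_sq hG, dualPolytope]
  refine (measureReal_union_le _ _).trans ?_
  rw [add_comm]
  exact le_mul_of_one_le_left (by positivity) (by linarith [(Nat.cast_nonneg k : (0 : ℝ) ≤ k)])

theorem Adj.cone_subset_tile (h : G.Adj w v) :
    convexHull ℝ (insert w (G.facet w v)) ⊆ G.tile w :=
  convexHull_min (insert_subset (G.mem_tile h.1) inter_subset_left) (G.convex_tile h.1)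

/-- Two points on the same ray from an interior point of a convex set, one of them in the set and
the other one on a supporting hyperplane. -/
theorem Separates.le_of_smul_eq {n y y' : EuclideanSpace ℝ (Fin (k + 1))} {c t t' : ℝ}
    (hs : G.Separates n c v w) (hy : y ∈ G.tile v) (hy' : ⟪n, y'⟫_ℝ = c) (ht : 0 ≤ t)
    (h : t • (y - v) = t' • (y' - v)) : t' ≤ t := by
  have h1 := congrArg (fun x => ⟪n, x⟫_ℝ) h
  simp only [inner_smul_right, inner_sub_right, hy'] at h1
  have h2 := hs.lt
  have h3 := hs.le y hy
  have h4 : t * (⟪n, y⟫_ℝ - ⟪n, v⟫_ℝ) ≤ t * (c - ⟪n, v⟫_ℝ) := by gcongr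
  exact le_of_mul_le_mul_right (h1 ▸ h4) (by linarith)

/-- A ray from `w` leaves the tile at one point only, so a common point of the cones other than `w`
comes from a point in both facets. The overlap is a cone over a null set. -/
theorem Adj.aedisjoint_cones {v v' : EuclideanSpace ℝ (Fin (k + 1))} (h : G.Adj w v)
    (h' : G.Adj w v') (hne : v ≠ v') :
    AEDisjoint volume (convexHull ℝ (insert w (G.facet w v)))
      (convexHull ℝ (insert w (G.facet w v'))) := by
  obtain ⟨n, c, hs⟩ := G.exists_separates h.1 h.2.1 h.2.2.1
  obtain ⟨n', c', hs'⟩ := G.exists_separates h'.1 h'.2.1 h'.2.2.1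
  have hsub : convexHull ℝ (insert w (G.facet w v)) ∩ convexHull ℝ (insert w (G.facet w v')) ⊆
      convexHull ℝ (insert w (G.facet w v ∩ G.facet w v')) := by
    rintro x ⟨hx, hx'⟩
    rw [convexHull_insert h.2.2.2.1, h.convex_facet.convexHull_eq, mem_convexJoin] at hx
    rw [convexHull_insert h'.2.2.2.1, h'.convex_facet.convexHull_eq, mem_convexJoin] at hx'
    simp only [mem_singleton_iff, exists_eq_left, segment_eq_image', mem_image] at hx hx'
    obtain ⟨y, hy, t, ht, rfl⟩ := hx
    obtain ⟨y', hy', t', ht', he⟩ := hx'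
    have he' := add_left_cancel he
    have h1 : t ≤ t' := hs.le_of_smul_eq hy'.1 (hs.inner_eq hy.1 hy.2) ht'.1 he'
    have h2 : t' ≤ t := hs'.le_of_smul_eq hy.1 (hs'.inner_eq hy'.1 hy'.2) ht.1 he'.symm
    obtain rfl := le_antisymm h1 h2
    rcases ht.1.eq_or_lt with rfl | ht0
    · rw [zero_smul, add_zero]
      exact subset_convexHull ℝ _ (mem_insert _ _)
    · have hyy : y' = y := by
        have := smul_right_injective _ ht0.ne' he'
        exact sub_left_injective this
      subst hyy
      have hc := convex_convexHull ℝ (insert w (G.facet w v ∩ G.facet w v'))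
      exact hc.add_smul_sub_mem (subset_convexHull ℝ _ (mem_insert _ _))
        (subset_convexHull ℝ _ (mem_insert_of_mem _ ⟨hy, hy'⟩)) ht
  refine measure_mono_null hsub ?_
  rcases (G.facet w v ∩ G.facet w v').eq_empty_or_nonempty with h0 | h0
  · rw [h0]; simp
  · rw [volume_convexHull_insert hs.norm_eq hs.lt (h.convex_facet.inter h'.convex_facet)
      (h.isCompact_facet.inter h'.isCompact_facet) (fun x hx => hs.inner_eq hx.1.1 hx.1.2) h0]
    have : μHE[k] (G.facet w v ∩ G.facet w v') = 0 :=
      measure_mono_null (t := G.tile w ∩ (G.tile v ∩ G.tile v'))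
        (fun x hx => ⟨hx.1.1, hx.1.2, hx.2.2⟩)
        (G.hausdorff_triple_eq_zero h.1 h.2.1 h'.2.1 h.2.2.1 h'.2.2.1 hne)
    rw [this, mul_zero]

variable (G)

theorem sum_volume_cone_le (hw : w ∈ G.verts) {N : Finset (EuclideanSpace ℝ (Fin (k + 1)))}
    (hN : ∀ v ∈ N, G.Adj w v) :
    ∑ v ∈ N, volume.real (convexHull ℝ (insert w (G.facet w v))) ≤ volume.real (G.tile w) := by
  rw [← measureReal_biUnion_finset₀ (fun v hv v' hv' hne => (hN v hv).aedisjoint_cones (hN v' hv') hne)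
    (fun v hv => ((hN v hv).measurableSet_cone w).nullMeasurableSet)
    (fun v hv => (hN v hv).volume_cone_ne_top w)]
  exact measureReal_mono (iUnion₂_subset fun v hv => (hN v hv).cone_subset_tile)
    (G.isCompact_tile hw).measure_ne_top

theorem sum_volume_tile_le {S : Finset (EuclideanSpace ℝ (Fin (k + 1)))}
    (hS : ∀ v ∈ S, v ∈ G.verts) {B : Set (EuclideanSpace ℝ (Fin (k + 1)))}
    (hB : ∀ v ∈ S, G.tile v ⊆ B) (hBf : volume B ≠ ⊤) :
    ∑ v ∈ S, volume.real (G.tile v) ≤ volume.real B := by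
  rw [← measureReal_biUnion_finset₀
    (fun v hv w hw hne => G.volume_tile_inter_tile (hS v hv) (hS w hw) hne)
    (fun v hv => (G.isCompact_tile (hS v hv)).isClosed.measurableSet.nullMeasurableSet)
    (fun v hv => (G.isCompact_tile (hS v hv)).measure_ne_top)]
  exact measureReal_mono (iUnion₂_subset hB) hBf

/-- The divergence theorem for a constant field: the coordinates are discrete harmonic. -/
theorem sum_cond_smul_sub (hG : G.IsOrthogonal) (hv : v ∈ G.verts)
    (hvD : G.tile v ⊆ interior D) {N : Finset (EuclideanSpace ℝ (Fin (k + 1)))}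
    (hN : ∀ w, w ∈ N ↔ G.Adj w v) : ∑ w ∈ N, G.cond w v • (w - v) = 0 := by
  refine ext_inner_right ℝ fun u => ?_
  have h := G.integral_tile_fderiv hG hv hvD hN (φ := fun _ => 1)
    (fun x _ => contDiffAt_const) u
  simp only [fderiv_fun_const, Pi.zero_apply, zero_apply, integral_zero, setIntegral_const,
    smul_eq_mul, mul_one] at h
  rw [inner_zero_left, sum_inner, h]
  refine Finset.sum_congr rfl fun w _ => ?_
  rw [real_inner_smul_left, cond_eq]
  ring

/-- The divergence theorem for each partial derivative in its own direction, summed over an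
orthonormal basis, turns the Laplacian into the flux of the gradient. -/
theorem sum_integral_facet_fderiv (hG : G.IsOrthogonal) (hv : v ∈ G.verts)
    (hvD : G.tile v ⊆ interior D) {N : Finset (EuclideanSpace ℝ (Fin (k + 1)))}
    (hN : ∀ w, w ∈ N ↔ G.Adj w v) {h : EuclideanSpace ℝ (Fin (k + 1)) → ℝ}
    (hh : ∀ x ∈ G.tile v, ContDiffAt ℝ 2 h x)
    (hΔ : ∀ x ∈ G.tile v, Laplacian.laplacian h x = 0) :
    ∑ w ∈ N, ∫ y in G.facet w v, ‖w - v‖⁻¹ * fderiv ℝ h y (w - v) ∂μHE[k] = 0 := by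
  let b := EuclideanSpace.basisFun (Fin (k + 1)) ℝ
  have hm := (G.isCompact_tile hv).isClosed.measurableSet
  have hd : ∀ x ∈ G.tile v, ContDiffAt ℝ 1 (fderiv ℝ h) x := fun x hx =>
    (hh x hx).fderiv_right (by norm_num)
  have hφ : ∀ u, ∀ x ∈ G.tile v, ContDiffAt ℝ 1 (fun y => fderiv ℝ h y u) x := fun u x hx =>
    (hd x hx).clm_apply contDiffAt_const
  have hcont : ∀ u, ContinuousOn (fun y => fderiv ℝ h y u) (G.tile v) := fun u x hx =>
    (hφ u x hx).continuousAt.continuousWithinAt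
  have hint : ∀ i, IntegrableOn (fun x => fderiv ℝ (fun y => fderiv ℝ h y (b i)) x (b i))
      (G.tile v) := by
    intro i
    refine ContinuousOn.integrableOn_compact (G.isCompact_tile hv) fun x hx => ?_
    exact (((hφ (b i) x hx).fderiv_right (m := 0)
      (by norm_num)).continuousAt.clm_apply continuousAt_const).continuousWithinAt
  have h1 : ∑ i, ∫ x in G.tile v, fderiv ℝ (fun y => fderiv ℝ h y (b i)) x (b i) = 0 := by
    rw [← integral_finsetSum _ fun i _ => hint i, setIntegral_congr_fun hm (g := fun _ => 0)]
    · simp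
    · intro x hx
      have := hΔ x hx
      rw [InnerProductSpace.laplacian_eq_iteratedFDeriv_orthonormalBasis h b] at this
      rw [← this]
      refine Finset.sum_congr rfl fun i _ => ?_
      rw [iteratedFDeriv_two_apply, fderiv_clm_apply ((hd x hx).differentiableAt one_ne_zero)
        (differentiableAt_const _)]
      simp
  rw [← h1]
  simp only [G.integral_tile_fderiv hG hv hvD hN (hφ _)]
  rw [Finset.sum_comm]
  refine Finset.sum_congr rfl fun w hw => ?_
  have hadj := (hN w).1 hw
  have hfc : ∀ u, ContinuousOn (fun y => fderiv ℝ h y u) (G.facet w v) := fun u =>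
    (hcont u).mono inter_subset_right
  rw [integral_const_mul]
  have h2 : ∀ y, fderiv ℝ h y (w - v) = ∑ i, ⟪w - v, b i⟫_ℝ * fderiv ℝ h y (b i) := by
    intro y
    conv_lhs => rw [← b.sum_repr' (w - v)]
    rw [map_sum]
    refine Finset.sum_congr rfl fun i _ => ?_
    rw [map_smul, smul_eq_mul, real_inner_comm]
  simp only [h2]
  rw [integral_finsetSum _ fun i _ => (hadj.integrableOn_facet (hfc (b i))).const_mul _,
    Finset.mul_sum]
  refine Finset.sum_congr rfl fun i _ => ?_
  rw [integral_const_mul, mul_assoc]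

end Tiling

/-! ### Comparing the discrete flow with the continuous flux -/

/-- The derivative is `M`-Lipschitz on `S`, and the segment from `p` to `q` stays within `r` of `y`
because balls are convex; the mean value inequality finishes. -/
theorem abs_sub_sub_fderiv_le {E : Type*} [NormedAddCommGroup E] [NormedSpace ℝ E]
    {h : E → ℝ} {S : Set E} (hS : Convex ℝ S) (hh : ∀ x ∈ S, ContDiffAt ℝ 2 h x) {M r : ℝ}
    (hM : ∀ x ∈ S, ‖iteratedFDeriv ℝ 2 h x‖ ≤ M) {p q y : E} (hp : p ∈ S) (hq : q ∈ S)
    (hy : y ∈ S) (hpr : ‖p - y‖ ≤ r) (hqr : ‖q - y‖ ≤ r) :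
    |h q - h p - fderiv ℝ h y (q - p)| ≤ M * r * ‖q - p‖ := by
  have hM0 : 0 ≤ M := (norm_nonneg _).trans (hM y hy)
  have hseg : segment ℝ p q ⊆ S := hS.segment_subset hp hq
  have hlip : ∀ x ∈ S, ‖fderiv ℝ h x - fderiv ℝ h y‖ ≤ M * ‖x - y‖ := fun x hx =>
    hS.norm_image_sub_le_of_norm_fderiv_le
      (fun z hz => ((hh z hz).fderiv_right (m := 1) (by norm_num)).differentiableAt one_ne_zero)
      (fun z hz => by
        have := norm_iteratedFDeriv_fderiv (𝕜 := ℝ) (f := h) (x := z) (n := 1)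
        rw [norm_iteratedFDeriv_one] at this
        rw [this]
        exact hM z hz) hy hx
  refine (convex_segment p q).norm_image_sub_le_of_norm_fderiv_le'
    (fun x hx => (hh x (hseg hx)).differentiableAt two_ne_zero)
    (fun x hx => (hlip x (hseg hx)).trans ?_) (left_mem_segment ℝ p q) (right_mem_segment ℝ p q)
  have hball : segment ℝ p q ⊆ Metric.closedBall y r :=
    (convex_closedBall y r).segment_subset (mem_closedBall_iff_norm.2 hpr)
      (mem_closedBall_iff_norm.2 hqr)
  exact mul_le_mul_of_nonneg_left (mem_closedBall_iff_norm.1 (hball hx)) hM0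

namespace Tiling

variable {k : ℕ} {D : Set (EuclideanSpace ℝ (Fin (k + 1)))} (G : Tiling (k + 1) D)
variable {v w : EuclideanSpace ℝ (Fin (k + 1))} {U : Set (EuclideanSpace ℝ (Fin (k + 1)))}

theorem finite_vertsIn (hUb : Bornology.IsBounded U) (hUD : closure U ⊆ D) :
    (G.vertsIn U).Finite :=
  (G.locallyFinite _ hUD hUb.isCompact_closure).subset fun v hv =>
    ⟨hv.1, v, G.mem_tile hv.1, subset_closure (interior_subset hv.2)⟩

variable {G}

theorem Adj.mem_touching (h : G.Adj w v) : w ∈ G.touching v := ⟨h.1, h.2.2.1, h.2.2.2.1⟩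

theorem Adj.mem_closedVerts (h : G.Adj w v) (hv : v ∈ G.vertsIn U) : w ∈ G.closedVerts U := by
  by_cases hw : w ∈ G.vertsIn U
  · exact Or.inl hw
  · exact Or.inr ⟨hw, v, hv, h⟩

theorem mem_verts_of_mem_closedVerts (hv : v ∈ G.closedVerts U) : v ∈ G.verts := by
  rcases hv with hv | ⟨-, z, -, hz⟩
  · exact hv.1
  · exact hz.1

variable (G)

theorem finite_closedVerts (hUb : Bornology.IsBounded U) (hUD : closure U ⊆ D)
    (hUi : ∀ v ∈ G.vertsIn U, G.tile v ⊆ interior D) : (G.closedVerts U).Finite := by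
  have hf := G.finite_vertsIn hUb hUD
  refine hf.union ((hf.biUnion fun v hv => G.finite_touching hv.1 (hUi v hv)).subset ?_)
  rintro w ⟨-, v, hv, h⟩
  exact mem_biUnion hv h.mem_touching

theorem isCompact_hat (hf : (G.closedVerts U).Finite) : IsCompact (G.hat U) :=
  hf.isCompact_biUnion fun _ hv => G.isCompact_tile (mem_verts_of_mem_closedVerts hv)

variable {G}

theorem Adj.isCompact_convexHull_dualPolytope (h : G.Adj w v) :
    IsCompact (convexHull ℝ (G.dualPolytope w v)) := by
  rw [dualPolytope, convexHull_union (insert_nonempty _ _).convexHull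
    (insert_nonempty _ _).convexHull, (convex_convexHull ℝ _).convexHull_eq,
    (convex_convexHull ℝ _).convexHull_eq]
  exact (isCompact_convexHull_insert h.isCompact_facet h.convex_facet w).convexJoin'
    (isCompact_convexHull_insert h.isCompact_facet h.convex_facet v)

variable (G)

theorem isCompact_hatHull (hf : (G.closedVerts U).Finite) : IsCompact (G.hatHull U) := by
  have hf' : (G.vertsIn U).Finite := hf.subset subset_union_left
  refine (G.isCompact_hat hf).union (hf'.isCompact_biUnion fun w _ =>
    hf'.isCompact_biUnion fun v _ => ?_)
  by_cases h : G.Adj w v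
  · simpa [h] using h.isCompact_convexHull_dualPolytope
  · simp [h]

theorem diam_tile_pos (hv : v ∈ G.verts) : 0 < Metric.diam (G.tile v) := by
  obtain ⟨r, hr, hball⟩ := Metric.isOpen_iff.1 isOpen_interior v (G.mem_interior v hv)
  set e : EuclideanSpace ℝ (Fin (k + 1)) := EuclideanSpace.single 0 (r / 2) with he
  have hnorm : ‖e‖ = r / 2 := by
    rw [he, PiLp.norm_single, Real.norm_eq_abs, abs_of_pos (by linarith)]
  have hmem : v + e ∈ G.tile v := interior_subset (hball (by
    rw [mem_ball_iff_norm, add_sub_cancel_left, hnorm]; linarith))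
  have h := Metric.dist_le_diam_of_mem (G.isCompact_tile hv).isBounded hmem (G.mem_tile hv)
  rw [dist_eq_norm, add_sub_cancel_left, hnorm] at h
  linarith

theorem norm_sub_le_diam (hv : v ∈ G.verts) {x y : EuclideanSpace ℝ (Fin (k + 1))}
    (hx : x ∈ G.tile v) (hy : y ∈ G.tile v) : ‖x - y‖ ≤ Metric.diam (G.tile v) := by
  rw [← dist_eq_norm]
  exact Metric.dist_le_diam_of_mem (G.isCompact_tile hv).isBounded hx hy

variable {G}

theorem Adj.norm_sub_le (h : G.Adj w v) :
    ‖w - v‖ ≤ Metric.diam (G.tile w) + Metric.diam (G.tile v) := by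
  obtain ⟨y, hy⟩ := h.2.2.2.1
  have h1 := G.norm_sub_le_diam h.1 (G.mem_tile h.1) hy.1
  have h2 := G.norm_sub_le_diam h.2.1 hy.2 (G.mem_tile h.2.1)
  have := norm_add_le (w - y) (y - v)
  rw [sub_add_sub_cancel] at this
  linarith

variable (G)

/-- The difference between the discrete flow `a(w, v) (h w - h v)` and the flux of `∇ h` through
the facet. -/
noncomputable def flowError (h : EuclideanSpace ℝ (Fin (k + 1)) → ℝ) (w v : EuclideanSpace ℝ (Fin (k + 1))) :
    ℝ :=
  ∫ y in G.facet w v, ‖w - v‖⁻¹ * (h w - h v - fderiv ℝ h y (w - v)) ∂μHE[k]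

theorem flowError_antisymm (h : EuclideanSpace ℝ (Fin (k + 1)) → ℝ)
    (w v : EuclideanSpace ℝ (Fin (k + 1))) : G.flowError h w v = -G.flowError h v w := by
  rw [flowError, flowError, ← integral_neg, facet_comm, norm_sub_rev]
  congr 1
  ext y
  rw [← neg_sub v w, map_neg]
  ring

variable {G}

theorem Adj.abs_flowError_le (hadj : G.Adj w v) {h : EuclideanSpace ℝ (Fin (k + 1)) → ℝ} {B : ℝ}
    (hB : ∀ y ∈ G.facet w v, |h w - h v - fderiv ℝ h y (w - v)| ≤ B) :
    |G.flowError h w v| ≤ G.cond w v * B := by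
  have h1 := norm_setIntegral_le_of_norm_le_const
    (f := fun y => ‖w - v‖⁻¹ * (h w - h v - fderiv ℝ h y (w - v))) (C := ‖w - v‖⁻¹ * B)
    hadj.hausdorff_facet_ne_top.lt_top fun y hy => by
      rw [norm_mul, norm_inv, norm_norm, Real.norm_eq_abs]
      gcongr
      exact hB y hy
  rw [Real.norm_eq_abs] at h1
  refine h1.trans_eq ?_
  rw [cond_eq]
  ring

variable (G)

/-- Flow minus flux, summed over the facets, loses the flux because `h` is harmonic on the tile. -/
theorem sum_flowError (hG : G.IsOrthogonal) (hv : v ∈ G.verts)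
    (hvD : G.tile v ⊆ interior D) {N : Finset (EuclideanSpace ℝ (Fin (k + 1)))}
    (hN : ∀ w, w ∈ N ↔ G.Adj w v) {h : EuclideanSpace ℝ (Fin (k + 1)) → ℝ}
    (hh : ∀ x ∈ G.tile v, ContDiffAt ℝ 2 h x)
    (hΔ : ∀ x ∈ G.tile v, Laplacian.laplacian h x = 0) :
    ∑ w ∈ N, G.flowError h w v = ∑ w ∈ N, G.cond w v * (h w - h v) := by
  rw [← sub_zero (∑ w ∈ N, G.cond w v * (h w - h v)),
    ← G.sum_integral_facet_fderiv hG hv hvD hN hh hΔ, ← Finset.sum_sub_distrib]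
  refine Finset.sum_congr rfl fun w hw => ?_
  have hadj := (hN w).1 hw
  have hint : IntegrableOn (fun y => ‖w - v‖⁻¹ * fderiv ℝ h y (w - v)) (G.facet w v) μHE[k] := by
    refine hadj.integrableOn_facet fun y hy => ?_
    exact (continuousAt_const.mul (((hh y hy.2).fderiv_right (m := 1)
      (by norm_num)).continuousAt.clm_apply continuousAt_const)).continuousWithinAt
  have hint' : IntegrableOn (fun _ => ‖w - v‖⁻¹ * (h w - h v)) (G.facet w v) μHE[k] :=
    hadj.integrableOn_facet continuousOn_const
  have h1 : G.cond w v * (h w - h v) =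
      ∫ _ in G.facet w v, ‖w - v‖⁻¹ * (h w - h v) ∂μHE[k] := by
    rw [setIntegral_const, smul_eq_mul, cond_eq]
    ring
  rw [h1, flowError, ← integral_sub hint' hint]
  congr 1
  ext y
  ring

theorem maxDualVolume_le {α m : ℝ} (hα : 0 < α) (hm : 0 ≤ m)
    (h : ∀ w, G.Adj w v → volume.real (G.dualPolytope w v) ≤ m) :
    G.maxDualVolume α v ≤ m ^ α := by
  -- Nonnegativity of the bound covers a vertex without edges, where the supremum is `0` by default.
  refine Real.sSup_le ?_ (Real.rpow_nonneg hm α)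
  rintro _ ⟨w, hw, rfl⟩
  exact Real.rpow_le_rpow measureReal_nonneg (h w hw) hα.le

theorem norm_iteratedFDeriv_le_hessianBound {K : Set (EuclideanSpace ℝ (Fin (k + 1)))}
    (hK : IsCompact K) {h : EuclideanSpace ℝ (Fin (k + 1)) → ℝ}
    (hh : ∀ x ∈ K, ContDiffAt ℝ 2 h x) : ∀ x ∈ K, ‖iteratedFDeriv ℝ 2 h x‖ ≤ hessianBound h K := by
  intro x hx
  have hcont : ContinuousOn (fun x => ‖iteratedFDeriv ℝ 2 h x‖) K := fun y hy =>
    ((hh y hy).continuousAt_iteratedFDeriv le_rfl).norm.continuousWithinAt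
  exact (le_csSup (hK.bddAbove_image hcont) (mem_image_of_mem _ hx)).trans (le_max_left _ _)

end Tiling

/-! ### The network of a tiling and the final estimate -/

theorem mainTheorem5 {d : ℕ} (hd : 1 ≤ d) (U : Set (EuclideanSpace ℝ (Fin d)))
    (hUo : IsOpen U) (hUc : IsConnected U) (hUb : Bornology.IsBounded U)
    (F α : ℝ) (hF : 0 < F) (hα : 0 < α) :
    ∃ C : ℝ, 0 < C ∧
      ∀ (D : Set (EuclideanSpace ℝ (Fin d))) (G : Tiling d D), G.IsOrthogonal →
        closure U ⊆ D →
        (∀ v ∈ G.vertsIn U, G.tile v ⊆ interior D) →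
        (∀ v ∈ G.vertsIn U, Metric.diam (G.tile v) ≤ F * G.maxDualVolume α v) →
      ∀ hC hD : EuclideanSpace ℝ (Fin d) → ℝ,
        (∀ x ∈ G.hatHull U, ContDiffAt ℝ 2 hC x) →
        (∀ x ∈ G.hat U, Laplacian.laplacian hC x = 0) →
        (∀ v ∈ G.vertsIn U, G.discreteLaplacian hD v = 0) →
        (∀ v ∈ G.bdryVerts U, hD v = hC v) →
        G.mesh U < (C * hessianBound hC (G.hatHull U))⁻¹ →
        ∀ v ∈ G.vertsIn U,
          |hD v - hC v| ≤
            C * hessianBound hC (G.hatHull U) * (G.mesh U * Real.log (G.mesh U)⁻¹) := by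
  classical
  obtain ⟨k, rfl⟩ : ∃ k, d = k + 1 := ⟨d - 1, by omega⟩
  obtain ⟨R₀, hR₀⟩ := hUb.subset_closedBall 0
  -- Boundary vertices lie within `2ε ≤ 1` of `U`, and tiles reach at most `ε` further, so the radii
  -- `R` and `R + 1` leave room.
  set R := R₀ + 2 with hR
  set B : Set (EuclideanSpace ℝ (Fin (k + 1))) := Metric.closedBall 0 (R + 1) with hB
  set A := 2 * (k + 1) * volume.real B with hA
  have hA0 : 0 ≤ A := by positivity
  set K := A + 2 * R ^ 2 + (Real.exp 1 * max 1 (F * (A + R ^ 2) ^ α)) ^ 2 / α + 1 with hK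
  have hK0 : 0 < K := by positivity
  -- The exponential makes the smallness of the mesh imply `L ≥ 1 + 2α`, hence `1 ≤ L`, `2α ≤ L` and
  -- `2ε ≤ 1`.
  set C := K + Real.exp (1 + 2 * α) with hCdef
  have hCpos : 0 < C := by positivity
  refine ⟨C, hCpos, ?_⟩
  intro D G hG hUD hUi hdiam hC hD hC2 hΔ hDΔ hbd hmesh z hz
  have hfin := G.finite_closedVerts hUb hUD hUi
  set M := hessianBound hC (G.hatHull U) with hM
  have hM1 : 1 ≤ M := le_max_right _ _
  have hhess := Tiling.norm_iteratedFDeriv_le_hessianBound (G.isCompact_hatHull hfin) hC2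
  rw [← hM] at hhess
  set ε := G.mesh U with hε
  have hdε : ∀ v ∈ G.closedVerts U, Metric.diam (G.tile v) ≤ ε := fun v hv =>
    le_csSup (hfin.image _).bddAbove (mem_image_of_mem _ hv)
  have hVcl : ∀ v ∈ G.vertsIn U, v ∈ G.closedVerts U := fun v hv => Or.inl hv
  have hε0 : 0 < ε := (G.diam_tile_pos hz.1).trans_le (hdε z (hVcl z hz))
  -- consequences of the smallness of the mesh
  set L := Real.log ε⁻¹ with hL
  have hεL : ε = Real.exp (-L) := by rw [hL, Real.log_inv, neg_neg, Real.exp_log hε0]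
  have hεC : ε ≤ Real.exp (-(1 + 2 * α)) := by
    refine hmesh.le.trans ?_
    rw [Real.exp_neg]
    refine inv_anti₀ (Real.exp_pos _) ?_
    calc Real.exp (1 + 2 * α) ≤ C := by rw [hCdef]; linarith
      _ ≤ C * M := le_mul_of_one_le_right hCpos.le hM1
  have hLα : 1 + 2 * α ≤ L := by
    rw [hεL, Real.exp_le_exp] at hεC
    linarith
  have hε2 : 2 * ε ≤ 1 := by
    have h1 : ε * Real.exp 1 ≤ 1 := by
      rw [hεL, ← Real.exp_add, Real.exp_le_one_iff]; linarith
    have h2 : 2 ≤ Real.exp 1 := by have := Real.add_one_le_exp 1; linarith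
    have := mul_le_mul_of_nonneg_left h2 hε0.le
    linarith
  -- tiles stay in a fixed ball
  have hnormV : ∀ v ∈ G.vertsIn U, ‖v‖ ≤ R₀ := fun v hv =>
    mem_closedBall_zero_iff.1 (hR₀ (interior_subset hv.2))
  have hnorm : ∀ v ∈ G.closedVerts U, ‖v‖ ≤ R := by
    rintro w (hw | hw)
    · linarith [hnormV w hw]
    · have hw' : w ∈ G.closedVerts U := Or.inr hw
      obtain ⟨-, v, hv, hadj⟩ := hw
      have h1 := hadj.norm_sub_le
      have h2 := hdε w hw'
      have h3 := hdε v (hVcl v hv)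
      have h4 := norm_sub_norm_le w v
      linarith [hnormV v hv]
  have htileB : ∀ v ∈ G.closedVerts U, G.tile v ⊆ B := by
    intro v hv x hx
    have hv' := Tiling.mem_verts_of_mem_closedVerts hv
    have h1 := G.norm_sub_le_diam hv' hx (G.mem_tile hv')
    have h2 := norm_sub_norm_le x v
    rw [hB, mem_closedBall_zero_iff]
    linarith [hnorm v hv, hdε v hv]
  -- the finite network
  obtain ⟨S, hS⟩ := hfin.exists_finset_coe
  have hSmem : ∀ v, v ∈ S ↔ v ∈ G.closedVerts U := fun v => by rw [← hS]; simp
  have hSverts : ∀ v ∈ S, v ∈ G.verts := fun v hv =>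
    Tiling.mem_verts_of_mem_closedVerts ((hSmem v).1 hv)
  set N : EuclideanSpace ℝ (Fin (k + 1)) → Finset (EuclideanSpace ℝ (Fin (k + 1))) :=
    fun v => S.filter fun w => G.Adj w v with hNdef
  have hN : ∀ v ∈ G.vertsIn U, ∀ w, w ∈ N v ↔ G.Adj w v := fun v hv w => by
    simp only [hNdef, Finset.mem_filter, and_iff_right_iff_imp]
    exact fun h => (hSmem w).2 (h.mem_closedVerts hv)
  have hsumN : ∀ (v : EuclideanSpace ℝ (Fin (k + 1))) (u : EuclideanSpace ℝ (Fin (k + 1)) → ℝ),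
      ∑ w : S, (if G.Adj w.1 v then u w.1 else 0) = ∑ w ∈ N v, u w := fun v u => by
    rw [Finset.sum_coe_sort S fun w => if G.Adj w v then u w else 0, Finset.sum_filter]
  set a : S → S → ℝ := fun w v => if G.Adj w.1 v.1 then G.cond w.1 v.1 else 0 with ha
  set V : Finset S := Finset.univ.filter fun v => v.1 ∈ G.vertsIn U with hV
  have hVmem : ∀ v : S, v ∈ V ↔ v.1 ∈ G.vertsIn U := fun v => by simp [hV]
  have hspeed : ∀ v : S, speedMeasure a (fun w => w.1) v =
      ∑ w ∈ N v.1, G.cond w v.1 * ‖w - v.1‖ ^ 2 := fun v => by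
    rw [← hsumN, speedMeasure]
    refine Finset.sum_congr rfl fun w _ => ?_
    simp only [ha]; split_ifs <;> simp
  have hvol : ∀ v : S, v ∈ V → ∀ w, G.Adj w v.1 →
      volume.real (G.dualPolytope w v.1) ≤ speedMeasure a (fun w => w.1) v := by
    intro v hv w hadj
    rw [hspeed]
    exact (hadj.volume_dualPolytope_le hG).trans (Finset.single_le_sum
      (f := fun w => G.cond w v.1 * ‖w - v.1‖ ^ 2)
      (fun w _ => mul_nonneg (G.cond_nonneg _ _) (sq_nonneg _))
      ((hN v.1 ((hVmem v).1 hv) w).2 hadj))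
  have ha0 : ∀ v w, 0 ≤ a v w := fun v w => by
    simp only [ha]; split_ifs
    · exact G.cond_nonneg _ _
    · exact le_rfl
  have hrF : ∀ v ∈ V, Metric.diam (G.tile v.1) ≤ F * speedMeasure a (fun w => w.1) v ^ α := by
    intro v hv
    refine (hdiam v.1 ((hVmem v).1 hv)).trans ?_
    gcongr
    exact G.maxDualVolume_le hα (speedMeasure_nonneg ha0 _ _) (hvol v hv)
  -- A tile has positive diameter, so the hypothesis on diameters rules out a vanishing speed
  -- measure.
  have hm : ∀ v ∈ V, 0 < speedMeasure a (fun w : S => w.1) v := by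
    intro v hv
    refine (speedMeasure_nonneg ha0 _ _).lt_of_ne fun h0 => ?_
    have h1 := hrF v hv
    rw [← h0, Real.zero_rpow hα.ne', mul_zero] at h1
    exact absurd h1 (not_le.2 (G.diam_tile_pos (hSverts v.1 v.2)))
  -- The cones with apex `v` do not overlap inside the tile of `v`. Each tile is used at most once
  -- for the cones at the centre of a sum and once for those at neighbours, whence the factor `2 *
  -- (k + 1)`.
  have hmA : ∑ v ∈ V, speedMeasure a (fun w : S => w.1) v ≤ A := by
    set VS := S.filter fun v => v ∈ G.vertsIn U with hVS
    set cone : EuclideanSpace ℝ (Fin (k + 1)) → EuclideanSpace ℝ (Fin (k + 1)) → ℝ :=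
      fun p q => volume.real (convexHull ℝ (insert p (G.facet p q))) with hcone
    have hcone0 : ∀ p q, 0 ≤ cone p q := fun p q => measureReal_nonneg
    have hVin : ∀ v ∈ VS, v ∈ S ∧ v ∈ G.vertsIn U := fun v hv => Finset.mem_filter.1 hv
    have hT : ∑ v ∈ S, volume.real (G.tile v) ≤ volume.real B :=
      G.sum_volume_tile_le hSverts (fun v hv => htileB v ((hSmem v).1 hv))
        measure_closedBall_lt_top.ne
    have h1 : ∑ v ∈ V, speedMeasure a (fun w : S => w.1) v =
        ∑ v ∈ VS, ∑ w ∈ S with G.Adj w v, (k + 1) * (cone v w + cone w v) := by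
      rw [hV, Finset.sum_filter, hVS, Finset.sum_filter, ← Finset.sum_coe_sort S]
      refine Finset.sum_congr rfl fun v _ => ?_
      split_ifs with hv
      · rw [hspeed]
        refine Finset.sum_congr rfl fun w hw => ?_
        rw [((hN v.1 hv w).1 hw).cond_mul_sq hG, hcone]
        simp only [G.facet_comm v.1 w]
      · rfl
    have h2 : ∑ v ∈ VS, ∑ w ∈ S with G.Adj w v, cone v w ≤ volume.real B := by
      refine le_trans ?_ hT
      calc _ ≤ ∑ v ∈ VS, volume.real (G.tile v) := Finset.sum_le_sum fun v hv =>
            G.sum_volume_cone_le (hSverts v (hVin v hv).1)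
              fun w hw => (Finset.mem_filter.1 hw).2.symm
        _ ≤ _ := Finset.sum_le_sum_of_subset_of_nonneg (Finset.filter_subset _ _)
            fun _ _ _ => measureReal_nonneg
    have h3 : ∑ v ∈ VS, ∑ w ∈ S with G.Adj w v, cone w v ≤ volume.real B := by
      refine le_trans ?_ hT
      have : ∑ v ∈ VS, ∑ w ∈ S with G.Adj w v, cone w v =
          ∑ w ∈ S, ∑ v ∈ VS with G.Adj w v, cone w v := by
        simp only [Finset.sum_filter]
        exact Finset.sum_comm
      rw [this]
      exact Finset.sum_le_sum fun w hw => G.sum_volume_cone_le (hSverts w hw)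
        fun v hv => (Finset.mem_filter.1 hv).2
    rw [h1]
    simp only [← Finset.mul_sum, Finset.sum_add_distrib]
    rw [hA]
    nlinarith [(Nat.cast_nonneg k : (0 : ℝ) ≤ k)]
  have hlin : ∀ v ∈ V, ∑ w : S, a w v • (w.1 - v.1) = 0 := by
    intro v hv
    have hv' := (hVmem v).1 hv
    rw [← G.sum_cond_smul_sub hG hv'.1 (hUi _ hv') (hN v.1 hv'), hNdef, Finset.sum_filter,
      ← Finset.sum_coe_sort S]
    refine Finset.sum_congr rfl fun w _ => ?_
    simp only [ha, ite_smul, zero_smul]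
  have hsymm : ∀ v w, a v w = a w v := fun v w => by
    simp only [ha]
    by_cases h : G.Adj v.1 w.1
    · rw [if_pos h, if_pos h.symm, G.cond_comm]
    · rw [if_neg h, if_neg fun h' => h h'.symm]
  -- The sign is that of `-hC` in `hD - hC`; `hD` itself contributes zero.
  set θ : S → S → ℝ := fun w v => if G.Adj w.1 v.1 then -G.flowError hC w.1 v.1 else 0 with hθ
  have hhat : ∀ v ∈ G.closedVerts U, G.tile v ⊆ G.hat U := fun v hv => subset_biUnion_of_mem
    (u := fun v => G.tile v) hv
  have hhatHull : G.hat U ⊆ G.hatHull U := subset_union_left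
  have hf : ∀ v ∉ V, hD v.1 - hC v.1 = 0 := by
    intro v hv
    rw [hVmem] at hv
    rcases (hSmem v.1).1 v.2 with h | h
    · exact absurd h hv
    · rw [hbd _ h, sub_self]
  have hθf : ∀ v ∈ V, networkLaplacian a (fun w : S => hD w.1 - hC w.1) v = ∑ w, θ w v := by
    intro v hv
    have hv' := (hVmem v).1 hv
    have h1 : ∑ w, θ w v = -∑ w ∈ N v.1, G.cond w v.1 * (hC w - hC v.1) := by
      rw [← G.sum_flowError hG hv'.1 (hUi _ hv') (hN _ hv')
        (fun x hx => hC2 x (hhatHull (hhat _ (hVcl _ hv') hx)))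
        (fun x hx => hΔ x (hhat _ (hVcl _ hv') hx)), ← Finset.sum_neg_distrib,
        ← hsumN v.1 fun w => -G.flowError hC w v.1]
    have h2 : ∑ w ∈ N v.1, G.cond w v.1 * (hD w - hD v.1) = 0 := by
      rw [← hDΔ v.1 hv', Tiling.discreteLaplacian]
      have : {w | G.Adj w v.1} = (N v.1 : Set (EuclideanSpace ℝ (Fin (k + 1)))) := by
        ext w; exact (hN _ hv' w).symm
      rw [this, finsum_mem_coe_finset]
    have h3 : networkLaplacian a (fun w : S => hD w.1 - hC w.1) v =
        ∑ w ∈ N v.1, G.cond w v.1 * ((hD w - hC w) - (hD v.1 - hC v.1)) := by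
      rw [networkLaplacian, ← hsumN v.1]
      refine Finset.sum_congr rfl fun w _ => ?_
      simp only [ha]; split_ifs <;> simp
    rw [h1, h3, ← zero_sub, ← h2, ← Finset.sum_sub_distrib]
    exact Finset.sum_congr rfl fun w _ => by ring
  have hθanti : ∀ v ∈ V, ∀ w ∈ V, θ w v = -θ v w := by
    intro v _ w _
    simp only [hθ]
    by_cases h : G.Adj w.1 v.1
    · rw [if_pos h, if_pos h.symm, G.flowError_antisymm]
    · rw [if_neg h, if_neg fun h' => h h'.symm, neg_zero]
  -- The segment from `v` to `w` may leave both tiles, so Taylor's formula is used on the convex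
  -- hull of the dual polytope.
  have hθV : ∀ v ∈ V, ∀ w ∈ V, |θ w v| ≤ a w v * ‖w.1 - v.1‖ *
      (M * max (Metric.diam (G.tile w.1)) (Metric.diam (G.tile v.1))) := by
    intro v hv w hw
    simp only [hθ, ha]
    by_cases h : G.Adj w.1 v.1
    · rw [if_pos h, if_pos h, abs_neg, mul_assoc]
      refine h.abs_flowError_le fun y hy => ?_
      have hsub : convexHull ℝ (G.dualPolytope w.1 v.1) ⊆ G.hatHull U := by
        refine subset_union_of_subset_right ?_ _
        intro x hx
        simp only [mem_iUnion]
        exact ⟨w.1, (hVmem w).1 hw, v.1, (hVmem v).1 hv, h, hx⟩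
      have hQ : G.dualPolytope w.1 v.1 ⊆ convexHull ℝ (G.dualPolytope w.1 v.1) :=
        subset_convexHull ℝ _
      have hins : ∀ p, insert p (G.facet w.1 v.1) ⊆ convexHull ℝ (insert p (G.facet w.1 v.1)) :=
        fun p => subset_convexHull ℝ _
      refine (abs_sub_sub_fderiv_le (convex_convexHull ℝ (G.dualPolytope w.1 v.1))
        (fun x hx => hC2 x (hsub hx)) (fun x hx => hhess x (hsub hx))
        (hQ (Or.inr (hins _ (mem_insert _ _)))) (hQ (Or.inl (hins _ (mem_insert _ _))))
        (hQ (Or.inl (hins _ (mem_insert_of_mem _ hy))))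
        ((G.norm_sub_le_diam h.2.1 (G.mem_tile h.2.1) hy.2).trans (le_max_right _ _))
        ((G.norm_sub_le_diam h.1 (G.mem_tile h.1) hy.1).trans (le_max_left _ _))).trans_eq ?_
      ring
    · simp [h]
  -- At the boundary that hull is not available. Going from `v` to `w` through a point of the facet
  -- stays in the two tiles and costs `2 M ε² ≤ M ε`.
  have hθB : ∀ v ∈ V, ∀ w ∉ V, |θ w v| ≤ a w v * (M * ε) := by
    intro v hv w _
    simp only [hθ, ha]
    by_cases h : G.Adj w.1 v.1
    · rw [if_pos h, if_pos h, abs_neg]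
      refine h.abs_flowError_le fun y hy => ?_
      have key : ∀ p : S, y ∈ G.tile p.1 →
          |hC p.1 - hC y - fderiv ℝ hC y (p.1 - y)| ≤ M * ε * ε := by
        intro p hyp
        have hp := (hSmem p.1).1 p.2
        have hpv := hSverts p.1 p.2
        have hsub := (hhat _ hp).trans hhatHull
        have h1 : ‖p.1 - y‖ ≤ ε :=
          (G.norm_sub_le_diam hpv (G.mem_tile hpv) hyp).trans (hdε _ hp)
        refine (abs_sub_sub_fderiv_le (G.convex_tile hpv) (fun x hx => hC2 x (hsub hx))
          (fun x hx => hhess x (hsub hx)) hyp (G.mem_tile hpv) hyp (by simpa using hε0.le)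
          h1).trans ?_
        gcongr
      have h1 := key w hy.1
      have h2 := key v hy.2
      have e : hC w.1 - hC v.1 - fderiv ℝ hC y (w.1 - v.1) =
          (hC w.1 - hC y - fderiv ℝ hC y (w.1 - y)) -
          (hC v.1 - hC y - fderiv ℝ hC y (v.1 - y)) := by
        simp only [map_sub]; ring
      rw [e]
      refine (abs_sub _ _).trans ?_
      have h3 : M * ε * (2 * ε) ≤ M * ε * 1 := by gcongr
      linarith
    · simp [h]
  have hfinal := abs_le_of_networkLaplacian_eq_div (x := fun w : S => w.1) (R := R) (z := ⟨z,
    (hSmem z).2 (hVcl z hz)⟩) hsymm ha0 (fun v => hnorm v.1 ((hSmem v.1).1 v.2)) hlin hm hmA hF hα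
    (by linarith) (by linarith) hεL (by linarith) (fun v => Metric.diam_nonneg)
    (fun v => hdε v.1 ((hSmem v.1).1 v.2)) hrF hf hθf hθanti hθV hθB ((hVmem _).2 hz)
  refine hfinal.trans ?_
  have hεL0 : 0 ≤ ε * L := mul_nonneg hε0.le (by linarith)
  rw [← hK]
  have hKC : K ≤ C := by rw [hCdef]; linarith [Real.exp_pos (1 + 2 * α)]
  gcongr
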